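/- Let $T,d\in\mathbb N$, let $X,X^1,X^2,\dots$ be random vectors in $\mathbb R^T$ and $Y,Y^1,Y^2,\dots$ random vectors in $(\mathbb R^d)^T$ on a probability space $(\Omega,\mathcal F,\mathbb P)$. For a path $(x,y)$ write $(x,y)_{\le t}=((x_1,y_1),\dots,(x_t,y_t))$. Let $\mathcal F_t=\sigma((X,Y)_{\le t})$ and $\mathcal F^n_t=\sigma((X^n,Y^n)_{\le t})$ for $1\le t\le T$, and let $\mathcal F_0=\mathcal F^n_0=\{\emptyset,\Omega\}$. Suppose that $\mathcal L(X^n,Y^n)\to\mathcal L(X,Y)$ weakly as $n\to\infty$, where $\mathcal L(X,Y)$ is Gaussian (possibly degenerate), and that $(\mathcal L(\|X^n\|^2))_{n}$ is uniformly integrable, where $\|\cdot\|$ is the Euclidean norm. Fix versions of the regular conditional distributions of $(X,Y)$ given $(X,Y)_{\le t}$ and of $(X^n,Y^n)$ given $(X^n,Y^n)_{\le t}$, $1\le t\le T$. Suppose that for each $t\in\{1,\dots,T\}$ and each convergent sequence $(x^n,y^n)_{\le t}\to(x,y)_{\le t}$ with $(x^n,y^n)_{\le t}\in\operatorname{supp}\mathcal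 L((X^n,Y^n)_{\le t})$ for all $n$ and $(x,y)_{\le t}\in\operatorname{supp}\mathcal L((X,Y)_{\le t})$, $$\mathcal L\big((X^n,Y^n)\mid (X^n,Y^n)_{\le t}=(x^n,y^n)_{\le t}\big)\to\mathcal L\big((X,Y)\mid (X,Y)_{\le t}=(x,y)_{\le t}\big)\quad\text{weakly as } n\to\infty,$$ and $\big(\mathcal L(\|X^n\|^2\mid (X^n,Y^n)_{\le t}=(x^n,y^n)_{\le t})\big)_{n}$ is uniformly integrable. Let $c_0,\dots,c_{T-1}\ge 0$ and, for square-integrable $W$, let $$\phi_t(W)=\operatorname E[W\mid\mathcal F_t]+c_t\operatorname{Var}(W\mid\mathcal F_t)^{1/2},\qquad \phi^n_t(W)=\operatorname E[W\mid\mathcal F^n_t]+c_t\operatorname{Var}(W\mid\mathcal F^n_t)^{1/2}.$$ Define $V_T(X)=0$, $V_t(X)=\phi_t(X_{t+1}+V_{t+1}(X))$ and $V^n_T(X^n)=0$, $V^n_t(X^n)=\phi^n_t(X^n_{t+1}+V^n_{t+1}(X^n))$ for $t<T$. Then $\lim_{n\to\infty}V^n_0(X^n)=V_0(X)$, and $$V_0(X)=\operatorname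 E\Big[\sum_{t=1}^TX_t\Big]+\sum_{t=1}^T\phi_{t-1}(\varepsilon_t)\Big(\operatorname{Var}\Big(\sum_{u=t}^TX_u\,\Big|\,\mathcal F_{t-1}\Big)-\operatorname{Var}\Big(\sum_{u=t}^TX_u\,\Big|\,\mathcal F_t\Big)\Big)^{1/2}\quad\text{almost surely},$$ where the differences of conditional variances are almost surely nonnegative, and $\varepsilon_t$ is standard normal and independent of $\mathcal F_{t-1}$, so that $\phi_{t-1}(\varepsilon_t)=c_{t-1}$; with $\phi_{t-1}(\varepsilon_t)$ replaced by $c_{t-1}$ the formula holds whether or not such $\varepsilon_t$ exist on $\Omega$. -/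

import Mathlib

open MeasureTheory ProbabilityTheory Filter
open scoped Topology ENNReal

noncomputable section

namespace MultiPeriod

/-- Paths `(x, y)` with `x ∈ ℝ^T` and `y ∈ (ℝ^d)^T`. The index `i : Fin T` stands for the
time point `i + 1`. -/
abbrev Path (T d : ℕ) : Type :=
  EuclideanSpace ℝ (Fin T) × (Fin T → EuclideanSpace ℝ (Fin d))

/-- Initial segments `(x, y)_{≤ t}`: one pair `(x_s, y_s)` for each of the first `t` times.
For `t = 0` this is a one-point space. -/
abbrev Past (T d t : ℕ) : Type :=
  {s : Fin T // (s : ℕ) < t} → ℝ × EuclideanSpace ℝ (Fin d)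

/-- The restriction `(x, y) ↦ (x, y)_{≤ t}`. -/
def past {T d : ℕ} (t : ℕ) (w : Path T d) : Past T d t :=
  fun s => (w.1 s.1, w.2 s.1)

variable {Ω : Type*} {mΩ : MeasurableSpace Ω} {T d : ℕ}

/-- The σ-algebra `σ((X, Y)_{≤ t})`; for `t = 0` it is the trivial one. -/
@[reducible] def info (Z : Ω → Path T d) (t : ℕ) : MeasurableSpace Ω :=
  MeasurableSpace.comap (fun ω => past t (Z ω)) inferInstance

/-- The one-step valuation `W ↦ E[W | m] + c * Var(W | m)^{1/2}`. -/
def oneStep (P : Measure Ω) (m : MeasurableSpace Ω) (c : ℝ) (W : Ω → ℝ) : Ω → ℝ :=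
  fun ω => (P[W | m]) ω + c * √(condVar m W P ω)

/-- The value process of the cashflow `X`, where `Z = (X, Y)`: `V_T = 0` and
`V_t = φ_t(X_{t+1} + V_{t+1})` for `t < T`, where `φ_t` is the one-step valuation given
`σ((X, Y)_{≤ t})` with constant `c_t`. -/
def value (P : Measure Ω) (c : Fin T → ℝ) (Z : Ω → Path T d) (t : ℕ) : Ω → ℝ :=
  if h : t < T then
    oneStep P (info Z t) (c ⟨t, h⟩) (fun ω => (Z ω).1 ⟨t, h⟩ + value P c Z (t + 1) ω)
  else 0
termination_by T - t

theorem value_last (P : Measure Ω) (c : Fin T → ℝ) (Z : Ω → Path T d) :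
    value P c Z T = 0 := by
  rw [value]; simp

theorem value_of_lt (P : Measure Ω) (c : Fin T → ℝ) (Z : Ω → Path T d) (i : Fin T) :
    value P c Z i =
      oneStep P (info Z i) (c i) (fun ω => (Z ω).1 i + value P c Z (i + 1) ω) := by
  rw [value]; simp

/-- `(ν_n)_n` is uniformly integrable: `sup_n ∫_{|x| > r} |x| ν_n(dx) → 0` as `r → ∞`. -/
def UnifIntegrableLaws (ν : ℕ → Measure ℝ) : Prop :=
  Tendsto (fun r : ℝ => ⨆ n, ∫⁻ x in {x : ℝ | r < |x|}, ‖x‖ₑ ∂(ν n)) atTop (𝓝 0)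

/-- The decrease in conditional variance
`Var(∑_{u ≥ t} X_u | (X, Y)_{≤ t-1}) - Var(∑_{u ≥ t} X_u | (X, Y)_{≤ t})`
at the time `t = i + 1`. -/
def varDrop (P : Measure Ω) (Z : Ω → Path T d) (i : Fin T) : Ω → ℝ :=
  fun ω =>
    condVar (info Z i) (fun ω' => ∑ u ∈ Finset.Ici i, (Z ω').1 u) P ω -
      condVar (info Z (i + 1)) (fun ω' => ∑ u ∈ Finset.Ici i, (Z ω').1 u) P ω

end MultiPeriod

end

/-! Gaussian part. If `S` is the sum of the payments after time `t`, linear regression makes `E[S |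
F_t]` affine in the past and every conditional variance of `S` constant
(`exists_condExp_eq_affine`). By backward induction `V_t = E[S | F_t] + const`: `X_{t+1} + V_{t+1}`
is again a conditional expectation plus a constant, and by the law of total variance the one-step
valuation adds `c_t` times the root of the variance drop (`condVar_condExp_of_const`,
`exists_value_eq_condExp_add`). This yields the formula, and a continuous version `a t` of the limit
values.

Convergence. Regular conditional laws turn `V^n_t` into functions of the past (`pathValue`), and
backward induction shows that they converge to `a t` along convergent sequences of pasts
(`tendsto_pathValue`). In one step, the integrands `x_{t+1} + V^n_{t+1}` converge locally uniformly
to a continuous limit, so their laws under the weakly convergent kernels converge. Their squares are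
uniformly integrable because `V^n_{t+1}` squared is at most a constant times the conditional second
moment of `‖x‖`, which the tower property reduces to the hypothesis. So the first two moments
converge, hence so does mean plus `c` times standard deviation (`tendsto_kernelStep`).

Null sets need care, since kernels are fixed versions evaluated at single points. `goodSet` collects
the pasts at which all required identities hold and from which the kernels almost surely reach good
pasts; it has full measure, so it contains the only past at time zero. -/

namespace MultiPeriod

/-! ### Weak convergence with varying integrands -/

section WeakConvergence

variable {E : Type*} [TopologicalSpace E] [MeasurableSpace E] [OpensMeasurableSpace E]

/-- If `μ_n → μ` weakly and `g_n - g` is eventually small near every point of a set of full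
`μ`-measure, then `g_n - g → 0` in probability under `μ_n`. -/
theorem tendsto_measure_lt_abs_sub_of_locally [HasOuterApproxClosed E]
    {μs : ℕ → ProbabilityMeasure E} {μ : ProbabilityMeasure E} (hμ : Tendsto μs atTop (𝓝 μ))
    {g : ℕ → E → ℝ} {g₀ : E → ℝ} {D : ℕ → Set E}
    (hD : ∀ n, ∀ᵐ w ∂(μs n : Measure E), w ∈ D n)
    (hloc : ∀ ε > 0, ∀ᵐ w ∂(μ : Measure E), ∃ U, IsOpen U ∧ w ∈ U ∧
      ∃ N, ∀ n ≥ N, ∀ w' ∈ U, w' ∈ D n → |g n w' - g₀ w'| ≤ ε)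
    {ε : ℝ} (hε : 0 < ε) :
    Tendsto (fun n => (μs n : Measure E) {w | ε < |g n w - g₀ w|}) atTop (𝓝 0) := by
  -- `U k` is the largest open set on which the bound holds from index `k` on. These sets increase
  -- to a set of full `μ`-measure, and the portmanteau bound for open sets carries the mass of one
  -- `U k` over to `μs n`.
  let U : ℕ → Set E := fun k =>
    ⋃₀ {O | IsOpen O ∧ ∀ n ≥ k, ∀ w' ∈ O, w' ∈ D n → |g n w' - g₀ w'| ≤ ε}
  have hUo : ∀ k, IsOpen (U k) := fun k => isOpen_sUnion fun O hO => hO.1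
  have hUm : Monotone U := fun k l hkl => Set.sUnion_subset_sUnion fun O hO =>
    ⟨hO.1, fun n hn => hO.2 n (hkl.trans hn)⟩
  have hU1 : (μ : Measure E) (⋃ k, U k) = 1 := by
    refine (mem_ae_iff_prob_eq_one (isOpen_iUnion hUo).measurableSet).1 ?_
    filter_upwards [hloc ε hε] with w ⟨O, hO, hw, N, hN⟩
    exact Set.mem_iUnion.2 ⟨N, O, ⟨hO, hN⟩, hw⟩
  have hlimU : Tendsto (fun k => (μ : Measure E) (U k)) atTop (𝓝 1) :=
    hU1 ▸ tendsto_measure_iUnion_atTop hUm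
  rw [ENNReal.tendsto_nhds_zero]
  intro δ hδ
  have h1 : 1 - δ < 1 := ENNReal.sub_lt_self ENNReal.one_ne_top one_ne_zero hδ.ne'
  obtain ⟨k, hk⟩ := (hlimU.eventually_const_lt h1).exists
  have h2 := eventually_lt_of_lt_liminf
    (hk.trans_le (ProbabilityMeasure.le_liminf_measure_open_of_tendsto hμ (hUo k)))
  filter_upwards [h2, eventually_ge_atTop k] with n hn hkn
  calc (μs n : Measure E) {w | ε < |g n w - g₀ w|}
      ≤ (μs n : Measure E) (U k)ᶜ := by
        refine measure_mono_ae ?_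
        filter_upwards [hD n] with w hw hlt hwU
        obtain ⟨O, hO, hwO⟩ := hwU
        exact absurd (hO.2 n hkn w hwO hw) (not_le.2 hlt)
    _ = 1 - (μs n : Measure E) (U k) := prob_compl_eq_one_sub (hUo k).measurableSet
    _ ≤ δ := by
        rw [tsub_le_iff_right, add_comm, ← tsub_le_iff_right]
        exact hn.le

/-- Convergence in probability under varying measures transfers weak convergence. -/
theorem tendsto_map_of_tendsto_measure_lt [BorelSpace E]
    {μs : ℕ → ProbabilityMeasure E} {μ : ProbabilityMeasure E} (hμ : Tendsto μs atTop (𝓝 μ))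
    {g : ℕ → E → ℝ} {g₀ : E → ℝ} (hg : ∀ n, Measurable (g n)) (hg₀ : Continuous g₀)
    (h : ∀ ε > 0, Tendsto (fun n => (μs n : Measure E) {w | ε < |g n w - g₀ w|}) atTop (𝓝 0)) :
    Tendsto (fun n => (μs n).map (hg n).aemeasurable) atTop
      (𝓝 (μ.map hg₀.measurable.aemeasurable)) := by
  rw [tendsto_iff_forall_lipschitz_integral_tendsto]
  intro f ⟨B, hB⟩ ⟨K, hK⟩
  have hfm : Continuous f := hK.continuous
  have hBn : 0 ≤ B := dist_nonneg.trans (hB 0 0)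
  have hint : ∀ (ν : ProbabilityMeasure E) {u : E → ℝ}, Measurable u →
      Integrable (fun w => f (u w)) (ν : Measure E) := fun ν u hu => by
    refine Integrable.of_bound (hfm.measurable.comp hu).aestronglyMeasurable (|f 0| + B)
      (ae_of_all _ fun w => ?_)
    have := hB (u w) 0
    rw [Real.dist_eq] at this
    rw [Real.norm_eq_abs]
    linarith [abs_sub_abs_le_abs_sub (f (u w)) (f 0)]
  have hbase : Tendsto (fun n => ∫ w, f (g₀ w) ∂(μs n : Measure E)) atTop
      (𝓝 (∫ w, f (g₀ w) ∂(μ : Measure E))) := by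
    have := (ProbabilityMeasure.tendsto_iff_forall_integral_tendsto.1
      (ProbabilityMeasure.tendsto_map_of_tendsto_of_continuous μs μ hμ hg₀))
      (BoundedContinuousFunction.mkOfBound ⟨f, hfm⟩ B hB)
    simpa [ProbabilityMeasure.toMeasure_map,
      integral_map hg₀.measurable.aemeasurable hfm.aestronglyMeasurable] using! this
  have hdiff : Tendsto (fun n => ∫ w, f (g n w) ∂(μs n : Measure E)
      - ∫ w, f (g₀ w) ∂(μs n : Measure E)) atTop (𝓝 0) := by
    rw [Metric.tendsto_atTop']
    intro δ hδ
    obtain ⟨ε, hε, hKε⟩ : ∃ ε > 0, K * ε < δ / 2 := by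
      refine ⟨δ / (2 * (K + 1)), by positivity, ?_⟩
      rw [mul_div_assoc', div_lt_div_iff₀ (by positivity) (by positivity)]
      nlinarith [K.coe_nonneg]
    have hs := (ENNReal.tendsto_toReal ENNReal.zero_ne_top).comp (h ε hε)
    have hs' := (hs.const_mul B)
    simp only [ENNReal.toReal_zero, mul_zero] at hs'
    obtain ⟨N, hN⟩ := (hs'.eventually_lt_const (half_pos hδ)).exists_forall_of_atTop
    refine ⟨N, fun n hn => ?_⟩
    have hNn := hN n hn.le
    rw [Real.dist_eq, sub_zero, ← integral_sub (hint _ (hg n)) (hint _ hg₀.measurable)]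
    have hSm : MeasurableSet {w | ε < |g n w - g₀ w|} :=
      measurableSet_lt measurable_const ((hg n).sub hg₀.measurable).abs
    have hIi : Integrable (fun w => K * ε +
        Set.indicator {w | ε < |g n w - g₀ w|} (fun _ => B) w) (μs n : Measure E) :=
      (integrable_const _).add ((integrable_const B).indicator hSm)
    -- Off the exceptional event the Lipschitz constant gives `K * ε`; on it the oscillation of `f`
    -- is at most `B`.
    have hpt : ∀ w, ‖f (g n w) - f (g₀ w)‖ ≤ K * ε +
        Set.indicator {w | ε < |g n w - g₀ w|} (fun _ => B) w := fun w => by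
      by_cases hw : ε < |g n w - g₀ w|
      · rw [Set.indicator_of_mem (by exact hw)]
        have := hB (g n w) (g₀ w)
        rw [Real.dist_eq] at this
        rw [Real.norm_eq_abs]
        have : 0 ≤ (K : ℝ) * ε := by positivity
        linarith
      · rw [Set.indicator_of_notMem (by exact hw), add_zero, ← dist_eq_norm]
        refine (hK.dist_le_mul _ _).trans ?_
        rw [Real.dist_eq]
        exact mul_le_mul_of_nonneg_left (not_lt.1 hw) K.coe_nonneg
    have := norm_integral_le_of_norm_le hIi (ae_of_all _ hpt)
    rw [integral_add (integrable_const _) ((integrable_const B).indicator hSm),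
      integral_indicator_const _ hSm] at this
    simp only [integral_const, probReal_univ, smul_eq_mul, one_mul] at this
    rw [Real.norm_eq_abs] at this
    simp only [Function.comp_apply, measureReal_def] at hNn this
    linarith [mul_comm B ((μs n : Measure E) {w | ε < |g n w - g₀ w|}).toReal]
  have := hdiff.add hbase
  simp only [sub_add_cancel, zero_add] at this
  simpa only [ProbabilityMeasure.toMeasure_map,
    integral_map (hg _).aemeasurable hfm.aestronglyMeasurable,
    integral_map hg₀.measurable.aemeasurable hfm.aestronglyMeasurable] using! this

end WeakConvergence

/-! ### Convergence of first and second moments -/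

section Moments

/-- Truncation at level `r` costs at most the integral of the positive part of `x ^ 2 - r ^ 2`.
Finiteness of that integral also supplies the integrability of `h`. -/
theorem abs_integral_sub_le_of_lintegral_le {ν : Measure ℝ} [IsProbabilityMeasure ν]
    {h : ℝ → ℝ} (hc : Continuous h) (hb : ∀ x, |h x| ≤ 1 + x ^ 2)
    {r η : ℝ} (hη : 0 ≤ η)
    (htr : ∀ x, |h x - h (max (-r) (min r x))| ≤ max (x ^ 2 - r ^ 2) 0)
    (htail : ∫⁻ x, ENNReal.ofReal (max (x ^ 2 - r ^ 2) 0) ∂ν ≤ ENNReal.ofReal η) :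
    |∫ x, h x ∂ν - ∫ x, h (max (-r) (min r x)) ∂ν| ≤ η := by
  have hτm : Measurable fun x : ℝ => max (x ^ 2 - r ^ 2) 0 := by fun_prop
  have hτi : Integrable (fun x : ℝ => max (x ^ 2 - r ^ 2) 0) ν := by
    refine ⟨hτm.aestronglyMeasurable, ?_⟩
    rw [hasFiniteIntegral_iff_ofReal (f := fun x : ℝ => max (x ^ 2 - r ^ 2) 0)
      (ae_of_all _ fun x => le_max_right _ _)]
    exact htail.trans_lt ENNReal.ofReal_lt_top
  have hhi : Integrable h ν := by
    refine ((integrable_const (1 + r ^ 2)).add hτi).mono' hc.aestronglyMeasurable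
      (ae_of_all _ fun x => (hb x).trans ?_)
    have := le_max_left (x ^ 2 - r ^ 2) 0
    simp only [Pi.add_apply]
    linarith
  have hti : Integrable (fun x => h (max (-r) (min r x))) ν := by
    refine (hhi.abs.add hτi).mono'
      (hc.measurable.comp (by fun_prop)).aestronglyMeasurable (ae_of_all _ fun x => ?_)
    have := htr x
    rw [abs_sub_comm] at this
    simp only [Pi.add_apply, Real.norm_eq_abs]
    linarith [abs_sub_abs_le_abs_sub (h (max (-r) (min r x))) (h x)]
  rw [← integral_sub hhi hti]
  refine (norm_integral_le_of_norm_le hτi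
    (ae_of_all _ fun x => (Real.norm_eq_abs _).trans_le (htr x))).trans ?_
  rw [integral_eq_lintegral_of_nonneg_ae (f := fun x : ℝ => max (x ^ 2 - r ^ 2) 0)
    (ae_of_all _ fun x => le_max_right _ _) hτm.aestronglyMeasurable]
  exact ENNReal.toReal_le_of_le_ofReal hη htail

/-- Weak convergence on the line together with uniformly small quadratic tails gives convergence
of integrals of functions of at most quadratic growth. -/
theorem tendsto_integral_of_quadratic_tails {νs : ℕ → ProbabilityMeasure ℝ}
    {ν : ProbabilityMeasure ℝ} (hν : Tendsto νs atTop (𝓝 ν))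
    (htail : ∀ η > 0, ∃ r ≥ 1, ∀ n,
      ∫⁻ x, ENNReal.ofReal (max (x ^ 2 - r ^ 2) 0) ∂(νs n : Measure ℝ) ≤ ENNReal.ofReal η)
    {h : ℝ → ℝ} (hc : Continuous h) (hb : ∀ x, |h x| ≤ 1 + x ^ 2)
    (htr : ∀ r ≥ 1, ∀ x, |h x - h (max (-r) (min r x))| ≤ max (x ^ 2 - r ^ 2) 0) :
    Tendsto (fun n => ∫ x, h x ∂(νs n : Measure ℝ)) atTop (𝓝 (∫ x, h x ∂(ν : Measure ℝ))) := by
  rw [Metric.tendsto_atTop]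
  intro δ hδ
  obtain ⟨r, hr, hrn⟩ := htail (δ / 4) (by positivity)
  -- The tail bound passes to the limit law: integrals of nonnegative continuous functions are lower
  -- semicontinuous under weak convergence.
  have hlim : ∫⁻ x, ENNReal.ofReal (max (x ^ 2 - r ^ 2) 0) ∂(ν : Measure ℝ)
      ≤ ENNReal.ofReal (δ / 4) := by
    refine (lintegral_le_liminf_lintegral_of_forall_isOpen_measure_le_liminf_measure
      (μs := fun n => (νs n : Measure ℝ)) (f := fun x => max (x ^ 2 - r ^ 2) 0) (by fun_prop)
      (fun x => le_max_right _ _)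
      fun G hG => ProbabilityMeasure.le_liminf_measure_open_of_tendsto hν hG).trans ?_
    exact liminf_le_of_le (by isBoundedDefault) fun b hb =>
      hb.exists.elim fun n hn => hn.trans (hrn n)
  have hbd : ∀ x, |max (-r) (min r x)| ≤ r := fun x =>
    abs_le.2 ⟨le_max_left _ _, max_le (by linarith) (min_le_left _ _)⟩
  have hB : ∀ x, |h (max (-r) (min r x))| ≤ 1 + r ^ 2 := fun x =>
    (hb _).trans (by have := sq_le_sq' (abs_le.1 (hbd x)).1 (abs_le.1 (hbd x)).2; linarith)
  have hmid := (ProbabilityMeasure.tendsto_iff_forall_integral_tendsto.1 hν)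
    (BoundedContinuousFunction.ofNormedAddCommGroup (fun x => h (max (-r) (min r x)))
      (hc.comp (by fun_prop)) (1 + r ^ 2) hB)
  simp only [BoundedContinuousFunction.coe_ofNormedAddCommGroup] at hmid
  obtain ⟨N, hN⟩ := Metric.tendsto_atTop.1 hmid (δ / 4) (by positivity)
  refine ⟨N, fun n hn => ?_⟩
  have h1 := abs_integral_sub_le_of_lintegral_le hc hb (by positivity) (htr r hr) (hrn n)
  have h2 := abs_integral_sub_le_of_lintegral_le hc hb (by positivity) (htr r hr) hlim
  have h3 := hN n hn
  rw [Real.dist_eq] at h3 ⊢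
  rw [abs_lt] at h3 ⊢
  rw [abs_le] at h1 h2
  constructor <;> linarith [h1.1, h1.2, h2.1, h2.2, h3.1, h3.2]

/-- For `|x| ≥ r ≥ 1` the factor `|x| + r` is at least one, so `|x| - r ≤ x ^ 2 - r ^ 2`. One tail
function thus serves both moments. -/
theorem abs_sub_truncation_le {r : ℝ} (hr : 1 ≤ r) (x : ℝ) :
    |x - max (-r) (min r x)| ≤ max (x ^ 2 - r ^ 2) 0 := by
  rcases le_total x (-r) with h | h
  · rw [min_eq_right (by linarith), max_eq_left h, abs_of_nonpos (by linarith)]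
    exact le_max_of_le_left (by nlinarith)
  rcases le_total r x with h' | h'
  · rw [min_eq_left h', max_eq_right (by linarith), abs_of_nonneg (by linarith)]
    exact le_max_of_le_left (by nlinarith)
  · rw [min_eq_right h', max_eq_right h, sub_self, abs_zero]
    exact le_max_right _ _

theorem abs_sq_sub_truncation_sq_le {r : ℝ} (hr : 1 ≤ r) (x : ℝ) :
    |x ^ 2 - (max (-r) (min r x)) ^ 2| ≤ max (x ^ 2 - r ^ 2) 0 := by
  rcases le_total x (-r) with h | h
  · rw [min_eq_right (by linarith), max_eq_left h, neg_sq, abs_of_nonneg (by nlinarith)]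
    exact le_max_left _ _
  rcases le_total r x with h' | h'
  · rw [min_eq_left h', max_eq_right (by linarith), abs_of_nonneg (by nlinarith)]
    exact le_max_left _ _
  · rw [min_eq_right h', max_eq_right h, sub_self, abs_zero]
    exact le_max_right _ _

/-- Convergence of the first two moments of `g_n` under `μ_n`. -/
theorem tendsto_integral_and_integral_sq {E : Type*} [TopologicalSpace E] [MeasurableSpace E]
    [BorelSpace E] [HasOuterApproxClosed E]
    {μs : ℕ → ProbabilityMeasure E} {μ : ProbabilityMeasure E} (hμ : Tendsto μs atTop (𝓝 μ))
    {g : ℕ → E → ℝ} {g₀ : E → ℝ} (hg : ∀ n, Measurable (g n)) (hg₀ : Continuous g₀)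
    {D : ℕ → Set E} (hD : ∀ n, ∀ᵐ w ∂(μs n : Measure E), w ∈ D n)
    (hloc : ∀ ε > 0, ∀ᵐ w ∂(μ : Measure E), ∃ U, IsOpen U ∧ w ∈ U ∧
      ∃ N, ∀ n ≥ N, ∀ w' ∈ U, w' ∈ D n → |g n w' - g₀ w'| ≤ ε)
    (htail : ∀ η > 0, ∃ r ≥ 1, ∀ n,
      ∫⁻ w, ENNReal.ofReal (max (g n w ^ 2 - r ^ 2) 0) ∂(μs n : Measure E) ≤ ENNReal.ofReal η) :
    Tendsto (fun n => ∫ w, g n w ∂(μs n : Measure E)) atTop (𝓝 (∫ w, g₀ w ∂(μ : Measure E))) ∧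
    Tendsto (fun n => ∫ w, g n w ^ 2 ∂(μs n : Measure E)) atTop
      (𝓝 (∫ w, g₀ w ^ 2 ∂(μ : Measure E))) := by
  have hν := tendsto_map_of_tendsto_measure_lt hμ hg hg₀
    fun ε hε => tendsto_measure_lt_abs_sub_of_locally hμ hD hloc hε
  have htail' : ∀ η > 0, ∃ r ≥ 1, ∀ n,
      ∫⁻ x, ENNReal.ofReal (max (x ^ 2 - r ^ 2) 0)
        ∂(((μs n).map (hg n).aemeasurable : ProbabilityMeasure ℝ) : Measure ℝ)
          ≤ ENNReal.ofReal η := fun η hη => by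
    obtain ⟨r, hr, hn⟩ := htail η hη
    refine ⟨r, hr, fun n => ?_⟩
    rw [ProbabilityMeasure.toMeasure_map, lintegral_map (by fun_prop) (hg n)]
    exact hn n
  have key : ∀ h : ℝ → ℝ, Continuous h → (∀ x, |h x| ≤ 1 + x ^ 2) →
      (∀ r ≥ 1, ∀ x, |h x - h (max (-r) (min r x))| ≤ max (x ^ 2 - r ^ 2) 0) →
      Tendsto (fun n => ∫ w, h (g n w) ∂(μs n : Measure E)) atTop
        (𝓝 (∫ w, h (g₀ w) ∂(μ : Measure E))) := fun h hc hb htr => by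
    have := tendsto_integral_of_quadratic_tails hν htail' hc hb htr
    simpa only [ProbabilityMeasure.toMeasure_map,
      integral_map (hg _).aemeasurable hc.aestronglyMeasurable,
      integral_map hg₀.measurable.aemeasurable hc.aestronglyMeasurable] using! this
  refine ⟨key (fun x => x) continuous_id (fun x => ?_) fun r hr x => abs_sub_truncation_le hr x,
    key (fun x => x ^ 2) (by fun_prop) (fun x => ?_)
      fun r hr x => abs_sq_sub_truncation_sq_le hr x⟩
  · rw [abs_le]; constructor <;> nlinarith [sq_nonneg (x + 1), sq_nonneg (x - 1)]
  · rw [abs_of_nonneg (sq_nonneg x)]; linarith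

end Moments

/-! ### Initial segments and their filtration -/

section Past

variable {T d : ℕ}

@[fun_prop]
theorem continuous_past (t : ℕ) : Continuous (past t : Path T d → Past T d t) := by
  unfold past
  fun_prop

@[fun_prop]
theorem measurable_past (t : ℕ) : Measurable (past t : Path T d → Past T d t) :=
  (continuous_past t).measurable

/-- The restriction of an initial segment to a shorter one. -/
def restrictPast {s t : ℕ} (h : s ≤ t) (z : Past T d t) : Past T d s :=
  fun i => z ⟨i.1, i.2.trans_le h⟩

@[fun_prop]
theorem measurable_restrictPast {s t : ℕ} (h : s ≤ t) :
    Measurable (restrictPast h : Past T d t → Past T d s) := by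
  unfold restrictPast
  fun_prop

variable {Ω : Type*} {mΩ : MeasurableSpace Ω}

theorem info_le {Z : Ω → Path T d} (hZ : Measurable Z) (t : ℕ) : info Z t ≤ mΩ :=
  ((measurable_past t).comp hZ).comap_le

theorem info_mono (Z : Ω → Path T d) {s t : ℕ} (h : s ≤ t) : info Z s ≤ info Z t := by
  rintro _ ⟨B, hB, rfl⟩
  exact ⟨restrictPast h ⁻¹' B, measurable_restrictPast h hB, rfl⟩

theorem info_zero (Z : Ω → Path T d) : info Z 0 = ⊥ := by
  have : (fun ω => past 0 (Z ω)) = fun _ => past 0 (0 : Path T d) := by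
    funext ω s
    exact absurd s.2 (Nat.not_lt_zero _)
  rw [info, this, MeasurableSpace.comap_const]

theorem measurable_coord_info (Z : Ω → Path T d) {i : Fin T} {t : ℕ} (h : (i : ℕ) < t) :
    Measurable[info Z t] fun ω => (Z ω).1 i := by
  have h1 : Measurable fun z : Past T d t => (z ⟨i, h⟩).1 := by fun_prop
  exact h1.comp (comap_measurable fun ω => past t (Z ω))

end Past

/-! ### The one-step valuation under a kernel -/

section KernelStep

variable {α E : Type*} [MeasurableSpace α] [MeasurableSpace E]

/-- The one-step valuation computed from a regular conditional law. -/
noncomputable def kernelStep (κ : Kernel α E) (c : ℝ) (g : E → ℝ) : α → ℝ :=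
  fun z => ∫ w, g w ∂κ z + c * √(∫ w, g w ^ 2 ∂κ z - (∫ w, g w ∂κ z) ^ 2)

theorem measurable_kernelStep (κ : Kernel α E) [IsMarkovKernel κ] (c : ℝ) {g : E → ℝ}
    (hg : Measurable g) : Measurable (kernelStep κ c g) := by
  have h1 : Measurable fun z => ∫ w, g w ∂κ z :=
    (hg.stronglyMeasurable.integral_kernel (κ := κ)).measurable
  have h2 : Measurable fun z => ∫ w, g w ^ 2 ∂κ z :=
    ((hg.pow_const 2).stronglyMeasurable.integral_kernel (κ := κ)).measurable
  unfold kernelStep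
  fun_prop

theorem memLp_two_of_lintegral_enorm_sq_ne_top {ν : Measure E} {g : E → ℝ} (hg : Measurable g)
    (h : ∫⁻ w, ‖g w‖ₑ ^ 2 ∂ν ≠ ∞) : MemLp g 2 ν := by
  refine ⟨hg.aestronglyMeasurable, ?_⟩
  rw [eLpNorm_lt_top_iff_lintegral_rpow_enorm_lt_top two_ne_zero ENNReal.ofNat_ne_top]
  simpa using! h.lt_top

/-- With mean `a` and standard deviation `s`, `(a + c s)² ≤ 2 (1 + c²) (a² + s²)`, and `a² + s²` is
the second moment. If that is infinite, so is the right-hand side. -/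
theorem enorm_sq_kernelStep_le (κ : Kernel α E) [IsMarkovKernel κ] (c : ℝ) {g : E → ℝ}
    (hg : Measurable g) (z : α) :
    ‖kernelStep κ c g z‖ₑ ^ 2 ≤ ENNReal.ofReal (2 * (1 + c ^ 2)) * ∫⁻ w, ‖g w‖ₑ ^ 2 ∂κ z := by
  by_cases h : ∫⁻ w, ‖g w‖ₑ ^ 2 ∂κ z = ∞
  · rw [h, ENNReal.mul_top (by rw [Ne, ENNReal.ofReal_eq_zero, not_le]; positivity)]
    exact le_top
  have hL := memLp_two_of_lintegral_enorm_sq_ne_top hg h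
  have hsq : ∀ x : ℝ, ‖x‖ₑ ^ 2 = ENNReal.ofReal (x ^ 2) := fun x => by
    rw [Real.enorm_eq_ofReal_abs, ← ENNReal.ofReal_pow (abs_nonneg x), sq_abs]
  have hvar : 0 ≤ ∫ w, g w ^ 2 ∂κ z - (∫ w, g w ∂κ z) ^ 2 := by
    have h1 := variance_eq_sub hL
    have h2 := variance_nonneg g (κ z)
    simp only [Pi.pow_apply] at h1
    linarith
  simp_rw [hsq]
  rw [← ofReal_integral_eq_lintegral_ofReal hL.integrable_sq (ae_of_all _ fun w => sq_nonneg _),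
    ← ENNReal.ofReal_mul (by positivity)]
  refine ENNReal.ofReal_le_ofReal ?_
  unfold kernelStep
  have hs := Real.sq_sqrt hvar
  set a := ∫ w, g w ∂κ z
  set s := √(∫ w, g w ^ 2 ∂κ z - a ^ 2)
  nlinarith [sq_nonneg (a - c * s), sq_nonneg (c * a), sq_nonneg s]

end KernelStep

/-! ### Good initial segments and the tower property -/

section GoodSet

variable {T d : ℕ}

/-- The initial segments in `A t` from which the kernels almost surely move on to initial
segments of the same kind. -/
def goodSet (κ : ∀ t : ℕ, Kernel (Past T d t) (Path T d)) (A : ∀ t, Set (Past T d t)) (t : ℕ) :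
    Set (Past T d t) :=
  {z | z ∈ A t ∧ if t < T then ∀ᵐ w ∂κ t z, past (t + 1) w ∈ goodSet κ A (t + 1) else True}
termination_by T - t

theorem goodSet_subset (κ : ∀ t : ℕ, Kernel (Past T d t) (Path T d)) (A : ∀ t, Set (Past T d t))
    {t : ℕ} {z : Past T d t} (hz : z ∈ goodSet κ A t) : z ∈ A t := by
  rw [goodSet] at hz
  exact hz.1

theorem ae_past_mem_goodSet {κ : ∀ t : ℕ, Kernel (Past T d t) (Path T d)}
    {A : ∀ t, Set (Past T d t)} {t : ℕ} (ht : t < T) {z : Past T d t} (hz : z ∈ goodSet κ A t) :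
    ∀ᵐ w ∂κ t z, past (t + 1) w ∈ goodSet κ A (t + 1) := by
  rw [goodSet] at hz
  simpa [ht] using hz.2

variable {Ω : Type*} {mΩ : MeasurableSpace Ω} {P : Measure Ω} [IsProbabilityMeasure P]
  {κ : ∀ t : ℕ, Kernel (Past T d t) (Path T d)} [∀ t, IsMarkovKernel (κ t)]
  {Z : Ω → Path T d}

theorem ae_ae_kernel_of_ae {t : ℕ} (hZ : Measurable Z)
    (hκ : HasCondDistrib Z (fun ω => past t (Z ω)) (κ t) P) {s : ℕ} {G : Set (Past T d s)}
    (hG : ∀ᵐ z ∂P.map (fun ω => past s (Z ω)), z ∈ G) :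
    ∀ᵐ z ∂P.map (fun ω => past t (Z ω)), ∀ᵐ w ∂κ t z, past s w ∈ G := by
  refine Measure.ae_ae_of_ae_compProd (p := fun q : Past T d t × Path T d => past s q.2 ∈ G) ?_
  rw [← hκ.map_eq]
  have hm : (P.map fun ω => (past t (Z ω), Z ω)).map (fun q => past s q.2) =
      P.map (fun ω => past s (Z ω)) := by
    rw [Measure.map_map (by fun_prop) (by fun_prop)]
    rfl
  rw [← hm] at hG
  exact ae_of_ae_map ((measurable_past s).comp measurable_snd).aemeasurable hG

/-- Backward induction: by disintegration, a set of full measure at time `t + 1` is almost surely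
reached under `κ t z` for almost every `z`. -/
theorem ae_mem_goodSet (hZ : Measurable Z)
    (hκ : ∀ t ≤ T, HasCondDistrib Z (fun ω => past t (Z ω)) (κ t) P)
    {A : ∀ t, Set (Past T d t)}
    (hA : ∀ t ≤ T, ∀ᵐ z ∂P.map (fun ω => past t (Z ω)), z ∈ A t) {t : ℕ} (ht : t ≤ T) :
    ∀ᵐ z ∂P.map (fun ω => past t (Z ω)), z ∈ goodSet κ A t := by
  induction ht using Nat.decreasingInduction with
  | self =>
    filter_upwards [hA T le_rfl] with z hz
    rw [goodSet]
    simpa using hz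
  | of_succ t ht ih =>
    filter_upwards [hA t ht.le, ae_ae_kernel_of_ae hZ (hκ t ht.le) ih] with z hz hz'
    rw [goodSet]
    exact ⟨hz, by simpa [show t < T from ht] using hz'⟩

/-- The tower property of the kernels holds from almost every initial segment. -/
theorem ae_lintegral_kernel_kernel (hZ : Measurable Z)
    {s t : ℕ} (hst : s ≤ t) (hs : HasCondDistrib Z (fun ω => past s (Z ω)) (κ s) P)
    (ht : HasCondDistrib Z (fun ω => past t (Z ω)) (κ t) P) :
    ∀ᵐ z ∂P.map (fun ω => past s (Z ω)), ∀ f : Path T d → ℝ≥0∞, Measurable f →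
      ∫⁻ w, ∫⁻ w', f w' ∂κ t (past t w) ∂κ s z = ∫⁻ w, f w ∂κ s z := by
  have hp := fun u : ℕ => (measurable_past (T := T) (d := d) u)
  have : IsProbabilityMeasure (P.map fun ω => past s (Z ω)) :=
    Measure.isProbabilityMeasure_map (by fun_prop)
  let η : Kernel (Past T d s) (Path T d) := ((κ t).comap (past t) (hp t)) ∘ₖ κ s
  -- Both kernels disintegrate the joint law of the past and the path, so they agree as measures
  -- almost everywhere. The exceptional null set therefore does not depend on `f`.
  have key : P.map (fun ω => past s (Z ω)) ⊗ₘ η = P.map (fun ω => past s (Z ω)) ⊗ₘ κ s := by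
    refine Measure.ext_of_lintegral _ fun f hf => ?_
    have e1 : ∀ h : Past T d s × Path T d → ℝ≥0∞, Measurable h →
        ∫⁻ z, ∫⁻ w, h (z, w) ∂κ s z ∂P.map (fun ω => past s (Z ω)) =
          ∫⁻ ω, h (past s (Z ω), Z ω) ∂P := fun h hh => by
      rw [← Measure.lintegral_compProd hh, ← hs.map_eq,
        lintegral_map hh (by fun_prop)]
    have e2 : ∀ h : Past T d t × Path T d → ℝ≥0∞, Measurable h →
        ∫⁻ ω, ∫⁻ w, h (past t (Z ω), w) ∂κ t (past t (Z ω)) ∂P =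
          ∫⁻ ω, h (past t (Z ω), Z ω) ∂P := fun h hh => by
      rw [← lintegral_map (f := fun z => ∫⁻ w, h (z, w) ∂κ t z) hh.lintegral_kernel_prod_right'
        (by fun_prop), ← Measure.lintegral_compProd hh, ← ht.map_eq,
        lintegral_map hh (by fun_prop)]
    rw [Measure.lintegral_compProd hf, Measure.lintegral_compProd hf, e1 f hf]
    have e3 : ∀ z, ∫⁻ w, f (z, w) ∂η z = ∫⁻ w, ∫⁻ w', f (z, w') ∂κ t (past t w) ∂κ s z := fun z => by
      simp only [η]
      rw [Kernel.lintegral_comp _ _ _ (by fun_prop)]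
      rfl
    simp_rw [e3]
    have hm : Measurable fun q : Past T d s × Path T d => ∫⁻ w', f (q.1, w') ∂κ t (past t q.2) := by
      have : Measurable fun q : (Past T d s × Path T d) × Path T d => f (q.1.1, q.2) := by fun_prop
      exact this.lintegral_kernel_prod_right' (κ := (κ t).comap
        (fun q : Past T d s × Path T d => past t q.2) ((hp t).comp measurable_snd))
    rw [e1 _ hm]
    exact e2 (fun q => f (restrictPast hst q.1, q.2))
      (hf.comp (((measurable_restrictPast hst).comp measurable_fst).prodMk measurable_snd))
  filter_upwards [Kernel.ae_eq_of_compProd_eq key] with z hz f hf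
  have h1 : ∫⁻ w, f w ∂η z = ∫⁻ w, ∫⁻ w', f w' ∂κ t (past t w) ∂κ s z :=
    Kernel.lintegral_comp _ _ _ hf
  rw [← h1, hz]

end GoodSet

/-! ### The value process as a function of the past -/

section Value

variable {T d : ℕ} {Ω : Type*} {mΩ : MeasurableSpace Ω} {P : Measure Ω}

theorem condVar_nonneg_ae {m : MeasurableSpace Ω} (W : Ω → ℝ) : 0 ≤ᵐ[P] condVar m W P :=
  condExp_nonneg (ae_of_all _ fun _ => sq_nonneg _)

theorem memLp_sqrt_condVar [IsProbabilityMeasure P] {m : MeasurableSpace Ω} (hm : m ≤ mΩ) (W : Ω → ℝ) :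
    MemLp (fun ω => √(condVar m W P ω)) 2 P := by
  have hmeas : Measurable[mΩ] (condVar m W P) := (stronglyMeasurable_condVar.mono hm).measurable
  rw [memLp_two_iff_integrable_sq hmeas.sqrt.aestronglyMeasurable]
  refine (integrable_condVar (m := m) (X := W)).congr ?_
  filter_upwards [condVar_nonneg_ae (P := P) (m := m) W] with ω hω
  exact (Real.sq_sqrt hω).symm

theorem oneStep_congr {m : MeasurableSpace Ω} {c : ℝ} {W W' : Ω → ℝ} (h : W =ᵐ[P] W') :
    oneStep P m c W =ᵐ[P] oneStep P m c W' := by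
  filter_upwards [condExp_congr_ae (m := m) h, condVar_congr_ae (m := m) h] with ω h1 h2
  simp only [oneStep, h1, h2]

theorem memLp_coord {Z : Ω → Path T d} (hX : MemLp (fun ω => (Z ω).1) 2 P) (i : Fin T) :
    MemLp (fun ω => (Z ω).1 i) 2 P := by
  refine hX.of_le ?_ (ae_of_all _ fun ω => PiLp.norm_apply_le _ i)
  exact (EuclideanSpace.proj (𝕜 := ℝ) i).continuous.comp_aestronglyMeasurable hX.1

variable [IsProbabilityMeasure P]

theorem memLp_oneStep {m : MeasurableSpace Ω} (hm : m ≤ mΩ) {c : ℝ} {W : Ω → ℝ}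
    (hW : MemLp W 2 P) : MemLp (oneStep P m c W) 2 P :=
  (hW.condExp one_le_two).add ((memLp_sqrt_condVar hm W).const_mul c)

theorem memLp_value {Z : Ω → Path T d} (hZ : Measurable Z) (c : Fin T → ℝ)
    (hX : MemLp (fun ω => (Z ω).1) 2 P) {t : ℕ} (ht : t ≤ T) : MemLp (value P c Z t) 2 P := by
  induction ht using Nat.decreasingInduction with
  | self => rw [value_last]; exact MemLp.zero
  | of_succ t ht ih =>
    have h := value_of_lt P c Z ⟨t, ht⟩
    simp only at h
    rw [h]
    exact memLp_oneStep (info_le hZ t) ((memLp_coord hX _).add ih)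

theorem condExp_info_eq_integral {κ : ∀ t : ℕ, Kernel (Past T d t) (Path T d)}
    [∀ t, IsMarkovKernel (κ t)] {Z : Ω → Path T d} (hZ : Measurable Z) {t : ℕ}
    (hκ : HasCondDistrib Z (fun ω => past t (Z ω)) (κ t) P) {g : Path T d → ℝ}
    (hg : Measurable g) (hi : Integrable (fun ω => g (Z ω)) P) :
    P[fun ω => g (Z ω) | info Z t] =ᵐ[P] fun ω => ∫ w, g w ∂κ t (past t (Z ω)) := by
  have hp : Measurable fun ω => past t (Z ω) := by fun_prop
  have h1 := condDistrib_ae_eq_of_measure_eq_compProd _ hZ.aemeasurable hκ.map_eq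
  filter_upwards [condExp_ae_eq_integral_condDistrib hp hZ.aemeasurable hg.stronglyMeasurable hi,
    ae_of_ae_map hp.aemeasurable h1] with ω h2 h3
  rw [h2, h3]

theorem oneStep_info_eq_kernelStep {κ : ∀ t : ℕ, Kernel (Past T d t) (Path T d)}
    [∀ t, IsMarkovKernel (κ t)] {Z : Ω → Path T d} (hZ : Measurable Z) {t : ℕ}
    (hκ : HasCondDistrib Z (fun ω => past t (Z ω)) (κ t) P) (c : ℝ) {g : Path T d → ℝ}
    (hg : Measurable g) (hi : MemLp (fun ω => g (Z ω)) 2 P) :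
    oneStep P (info Z t) c (fun ω => g (Z ω)) =ᵐ[P]
      fun ω => kernelStep (κ t) c g (past t (Z ω)) := by
  filter_upwards [condExp_info_eq_integral hZ hκ hg (hi.integrable one_le_two),
    condExp_info_eq_integral hZ hκ (hg.pow_const 2) hi.integrable_sq,
    condVar_ae_eq_condExp_sq_sub_sq_condExp (info_le hZ t) hi] with ω h1 h2 h3
  simp only [oneStep, kernelStep, h3, Pi.sub_apply, Pi.pow_apply, h1]
  rw [← h2]
  rfl

/-- The value process as a function of the initial segment, computed from regular conditional
laws. -/
noncomputable def pathValue (c : Fin T → ℝ) (κ : ∀ t : ℕ, Kernel (Past T d t) (Path T d))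
    (t : ℕ) : Past T d t → ℝ :=
  if h : t < T then
    kernelStep (κ t) (c ⟨t, h⟩) fun w => w.1 ⟨t, h⟩ + pathValue c κ (t + 1) (past (t + 1) w)
  else 0
termination_by T - t

theorem pathValue_of_le (c : Fin T → ℝ) (κ : ∀ t : ℕ, Kernel (Past T d t) (Path T d)) {t : ℕ}
    (ht : T ≤ t) : pathValue c κ t = 0 := by
  rw [pathValue, dif_neg (not_lt.2 ht)]

theorem pathValue_of_lt (c : Fin T → ℝ) (κ : ∀ t : ℕ, Kernel (Past T d t) (Path T d)) (i : Fin T) :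
    pathValue c κ i =
      kernelStep (κ i) (c i) fun w => w.1 i + pathValue c κ (i + 1) (past (i + 1) w) := by
  rw [pathValue, dif_pos i.2]

theorem measurable_coord (i : Fin T) : Measurable fun w : Path T d => w.1 i := by fun_prop

theorem measurable_pathValue (c : Fin T → ℝ) (κ : ∀ t : ℕ, Kernel (Past T d t) (Path T d))
    [∀ t, IsMarkovKernel (κ t)] (t : ℕ) : Measurable (pathValue c κ t) := by
  by_cases ht : t ≤ T
  · induction ht using Nat.decreasingInduction with
    | self => rw [pathValue_of_le c κ le_rfl]; exact measurable_const
    | of_succ t ht ih =>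
      have h := pathValue_of_lt c κ ⟨t, ht⟩
      simp only at h
      rw [h]
      exact measurable_kernelStep _ _ ((measurable_coord _).add (ih.comp (measurable_past _)))
  · rw [pathValue_of_le c κ (not_le.1 ht).le]; exact measurable_const

/-- Replaces a process defined up to null sets by a function that can be evaluated along sequences
of pasts. -/
theorem value_eq_pathValue {κ : ∀ t : ℕ, Kernel (Past T d t) (Path T d)}
    [∀ t, IsMarkovKernel (κ t)] {Z : Ω → Path T d} (hZ : Measurable Z)
    (hκ : ∀ t ≤ T, HasCondDistrib Z (fun ω => past t (Z ω)) (κ t) P) (c : Fin T → ℝ)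
    (hX : MemLp (fun ω => (Z ω).1) 2 P) {t : ℕ} (ht : t ≤ T) :
    value P c Z t =ᵐ[P] fun ω => pathValue c κ t (past t (Z ω)) := by
  induction ht using Nat.decreasingInduction with
  | self => rw [value_last, pathValue_of_le c κ le_rfl]; rfl
  | of_succ t ht ih =>
    have h := value_of_lt P c Z ⟨t, ht⟩
    have h' := pathValue_of_lt c κ ⟨t, ht⟩
    simp only at h h'
    rw [h, h']
    have hW : (fun ω => (Z ω).1 ⟨t, ht⟩ + value P c Z (t + 1) ω) =ᵐ[P]
        fun ω => (Z ω).1 ⟨t, ht⟩ + pathValue c κ (t + 1) (past (t + 1) (Z ω)) := by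
      filter_upwards [ih] with ω hω
      rw [hω]
    have hL := (memLp_coord hX ⟨t, ht⟩).add (memLp_value hZ c hX (t := t + 1) ht)
    exact (oneStep_congr hW).trans (oneStep_info_eq_kernelStep hZ (hκ t (Nat.le_of_lt ht)) _
      ((measurable_coord _).add ((measurable_pathValue c κ _).comp (measurable_past _)))
      (hL.ae_eq hW))

/-- Conditioning on the trivial σ-algebra gives constants everywhere, not just almost everywhere, so
convergence at time zero makes sense at each `ω`. -/
theorem value_zero_eq_const {Z : Ω → Path T d} (c : Fin T → ℝ) (ω ω' : Ω) :
    value P c Z 0 ω = value P c Z 0 ω' := by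
  rcases Nat.eq_zero_or_pos T with rfl | hT
  · rw [value_last]; rfl
  · have h := value_of_lt P c Z ⟨0, hT⟩
    simp only at h
    rw [h]
    simp only [oneStep, info_zero, condExp_bot, condVar_bot']

end Value

/-! ### Second-moment and tail bounds for the values -/

section Bounds

variable {T d : ℕ}

/-- The initial segments from which the tower property of the kernels holds in one step. -/
def towerSet (κ : ∀ t : ℕ, Kernel (Past T d t) (Path T d)) (t : ℕ) : Set (Past T d t) :=
  {z | t < T → ∀ f : Path T d → ℝ≥0∞, Measurable f →
    ∫⁻ w, ∫⁻ w', f w' ∂κ (t + 1) (past (t + 1) w) ∂κ t z = ∫⁻ w, f w ∂κ t z}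

theorem measurable_enorm_sq : Measurable fun w : Path T d => ‖w.1‖ₑ ^ 2 := by fun_prop

theorem enorm_add_sq_le (a b : ℝ) : ‖a + b‖ₑ ^ 2 ≤ 2 * (‖a‖ₑ ^ 2 + ‖b‖ₑ ^ 2) := by
  have hsq : ∀ x : ℝ, ‖x‖ₑ ^ 2 = ENNReal.ofReal (x ^ 2) := fun x => by
    rw [Real.enorm_eq_ofReal_abs, ← ENNReal.ofReal_pow (abs_nonneg x), sq_abs]
  rw [hsq, hsq, hsq, ← ENNReal.ofReal_add (sq_nonneg _) (sq_nonneg _), ← ENNReal.ofReal_ofNat 2,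
    ← ENNReal.ofReal_mul zero_le_two]
  exact ENNReal.ofReal_le_ofReal (by nlinarith [sq_nonneg (a - b)])

theorem enorm_coord_le (w : Path T d) (i : Fin T) : ‖w.1 i‖ₑ ≤ ‖w.1‖ₑ := by
  rw [enorm_le_iff_norm_le]
  exact PiLp.norm_apply_le _ i

theorem enorm_sq_coord_add_le {w : Path T d} (i : Fin T) {v : ℝ} {C : NNReal} {h : ℝ≥0∞}
    (hv : ‖v‖ₑ ^ 2 ≤ C * h) :
    ‖w.1 i + v‖ₑ ^ 2 ≤ ((2 * (1 + C) : NNReal) : ℝ≥0∞) * (‖w.1‖ₑ ^ 2 + h) := by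
  refine (enorm_add_sq_le _ _).trans ?_
  push_cast
  rw [mul_assoc]
  gcongr 2 * ?_
  calc ‖w.1 i‖ₑ ^ 2 + ‖v‖ₑ ^ 2 ≤ ‖w.1‖ₑ ^ 2 + C * h := by
        gcongr
        exact enorm_coord_le w i
    _ ≤ (‖w.1‖ₑ ^ 2 + h) + C * (‖w.1‖ₑ ^ 2 + h) := by
        gcongr
        · exact le_self_add
        · exact le_add_self
    _ = (1 + C) * (‖w.1‖ₑ ^ 2 + h) := by ring

/-- From good initial segments, the squared value is controlled by the conditional second moment
of the cash flow. -/
theorem exists_enorm_sq_pathValue_le (c : Fin T → ℝ) {t : ℕ} (ht : t ≤ T) :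
    ∃ C : NNReal, ∀ (κ : ∀ t : ℕ, Kernel (Past T d t) (Path T d)) [∀ t, IsMarkovKernel (κ t)]
      (A : ∀ t, Set (Past T d t)), (∀ t < T, A t ⊆ towerSet κ t) →
      ∀ z ∈ goodSet κ A t, ‖pathValue c κ t z‖ₑ ^ 2 ≤ C * ∫⁻ w, ‖w.1‖ₑ ^ 2 ∂κ t z := by
  induction ht using Nat.decreasingInduction with
  | self => exact ⟨0, fun κ _ A _ z _ => by simp [pathValue_of_le c κ le_rfl]⟩
  | of_succ t ht ih =>
    obtain ⟨C, hC⟩ := ih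
    -- The first factor comes from `enorm_sq_kernelStep_le`. The second is `2 * (1 + C)` from
    -- squaring the sum, doubled because the tower property makes both integrals equal. The constant
    -- is independent of the kernels, hence of `n`.
    refine ⟨Real.toNNReal (2 * (1 + c ⟨t, ht⟩ ^ 2)) * (4 * (1 + C)), fun κ _ A hA z hz => ?_⟩
    have h' := pathValue_of_lt c κ ⟨t, ht⟩
    simp only at h'
    rw [h']
    refine (enorm_sq_kernelStep_le _ _ ((measurable_coord _).add
      ((measurable_pathValue c κ _).comp (measurable_past _))) z).trans ?_
    rw [ENNReal.coe_mul, mul_assoc, ENNReal.ofReal]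
    refine mul_le_mul' le_rfl ?_
    calc ∫⁻ w, ‖w.1 ⟨t, ht⟩ + pathValue c κ (t + 1) (past (t + 1) w)‖ₑ ^ 2 ∂κ t z
        ≤ ∫⁻ w, ((2 * (1 + C) : NNReal) : ℝ≥0∞) *
            (‖w.1‖ₑ ^ 2 + ∫⁻ w', ‖w'.1‖ₑ ^ 2 ∂κ (t + 1) (past (t + 1) w)) ∂κ t z := by
          refine lintegral_mono_ae ?_
          filter_upwards [ae_past_mem_goodSet ht hz] with w hw
          exact enorm_sq_coord_add_le _ (hC κ A hA _ hw)
      _ = ((2 * (1 + C) : NNReal) : ℝ≥0∞) *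
            (∫⁻ w, ‖w.1‖ₑ ^ 2 ∂κ t z + ∫⁻ w, ‖w.1‖ₑ ^ 2 ∂κ t z) := by
          rw [lintegral_const_mul' _ _ ENNReal.coe_ne_top, lintegral_add_left measurable_enorm_sq,
            hA t ht (goodSet_subset κ A hz) ht _ measurable_enorm_sq]
      _ = ((4 * (1 + C) : NNReal) : ℝ≥0∞) * ∫⁻ w, ‖w.1‖ₑ ^ 2 ∂κ t z := by
          push_cast
          ring

/-- The squared integrand is at most `2 * (1 + C)` times `‖w.1‖²` plus its next conditional mean.
Splitting off `M` from each term costs `4 * (1 + C) * M ≤ r ^ 2`, and the tower property merges the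
two remaining excesses. -/
theorem lintegral_tail_coord_add_pathValue_le (c : Fin T → ℝ) (i : Fin T) {C : NNReal}
    {κ : ∀ t : ℕ, Kernel (Past T d t) (Path T d)} [∀ t, IsMarkovKernel (κ t)]
    {z : Past T d i} (hz : z ∈ towerSet κ i)
    (hC : ∀ᵐ w ∂κ i z, ‖pathValue c κ (i + 1) (past (i + 1) w)‖ₑ ^ 2 ≤
      C * ∫⁻ w', ‖w'.1‖ₑ ^ 2 ∂κ (i + 1) (past (i + 1) w)) {r M : ℝ} (hM : 0 ≤ M)
    (hr : 4 * (1 + C) * M ≤ r ^ 2) :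
    ∫⁻ w, ENNReal.ofReal
        (max ((w.1 i + pathValue c κ (i + 1) (past (i + 1) w)) ^ 2 - r ^ 2) 0) ∂κ i z ≤
      ((4 * (1 + C) : NNReal) : ℝ≥0∞) * ∫⁻ w, (‖w.1‖ₑ ^ 2 - ENNReal.ofReal M) ∂κ i z := by
  have hm : Measurable fun w : Path T d => ‖w.1‖ₑ ^ 2 - ENNReal.ofReal M := by fun_prop
  calc ∫⁻ w, ENNReal.ofReal
        (max ((w.1 i + pathValue c κ (i + 1) (past (i + 1) w)) ^ 2 - r ^ 2) 0) ∂κ i z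
      ≤ ∫⁻ w, ((2 * (1 + C) : NNReal) : ℝ≥0∞) * ((‖w.1‖ₑ ^ 2 - ENNReal.ofReal M) +
          ∫⁻ w', (‖w'.1‖ₑ ^ 2 - ENNReal.ofReal M) ∂κ (i + 1) (past (i + 1) w)) ∂κ i z := by
        refine lintegral_mono_ae ?_
        filter_upwards [hC] with w hw
        set g := w.1 i + pathValue c κ (i + 1) (past (i + 1) w)
        have h1 : ‖g‖ₑ ^ 2 ≤ _ := enorm_sq_coord_add_le i hw
        have h2 : ∫⁻ w', ‖w'.1‖ₑ ^ 2 ∂κ (i + 1) (past (i + 1) w) ≤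
            ∫⁻ w', (‖w'.1‖ₑ ^ 2 - ENNReal.ofReal M) ∂κ (i + 1) (past (i + 1) w) +
              ENNReal.ofReal M := by
          calc _ ≤ ∫⁻ w', ((‖w'.1‖ₑ ^ 2 - ENNReal.ofReal M) + ENNReal.ofReal M)
                  ∂κ (i + 1) (past (i + 1) w) := lintegral_mono fun w' => le_tsub_add
            _ = _ := by rw [lintegral_add_left hm]; simp
        have h3 : ENNReal.ofReal (max (g ^ 2 - r ^ 2) 0) = ‖g‖ₑ ^ 2 - ENNReal.ofReal (r ^ 2) := by
          rw [Real.enorm_eq_ofReal_abs, ← ENNReal.ofReal_pow (abs_nonneg g), sq_abs,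
            ← ENNReal.ofReal_sub _ (sq_nonneg r), ENNReal.ofReal_max]
          simp
        have h4 : ((2 * (1 + C) : NNReal) : ℝ≥0∞) * (ENNReal.ofReal M + ENNReal.ofReal M) ≤
            ENNReal.ofReal (r ^ 2) := by
          rw [← ENNReal.ofReal_add hM hM, ← ENNReal.ofReal_coe_nnreal,
            ← ENNReal.ofReal_mul (NNReal.coe_nonneg _)]
          refine ENNReal.ofReal_le_ofReal (le_trans (le_of_eq ?_) hr)
          push_cast
          ring
        rw [h3, tsub_le_iff_right]
        refine h1.trans (le_trans ?_ (add_le_add_right h4 _))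
        rw [← mul_add]
        refine mul_le_mul' le_rfl ?_
        refine (add_le_add
          (le_tsub_add : ‖w.1‖ₑ ^ 2 ≤ ‖w.1‖ₑ ^ 2 - ENNReal.ofReal M + ENNReal.ofReal M) h2).trans (le_of_eq ?_)
        ring
    _ = ((4 * (1 + C) : NNReal) : ℝ≥0∞) * ∫⁻ w, (‖w.1‖ₑ ^ 2 - ENNReal.ofReal M) ∂κ i z := by
        rw [lintegral_const_mul' _ _ ENNReal.coe_ne_top, lintegral_add_left hm, hz i.2 _ hm]
        push_cast
        ring

/-- The excess of `y ≥ 0` over `M` is at most `y` on `{y > M}` and zero elsewhere. Unlike the tail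
integral, the excess form combines well with sums and the tower property. -/
theorem exists_lintegral_sub_le_of_unifIntegrableLaws {μs : ℕ → Measure (Path T d)}
    (h : UnifIntegrableLaws fun n => (μs n).map fun w => ‖w.1‖ ^ 2) {η : ℝ≥0∞} (hη : 0 < η) :
    ∃ M : ℝ, 0 ≤ M ∧ ∀ n, ∫⁻ w, (‖w.1‖ₑ ^ 2 - ENNReal.ofReal M) ∂μs n ≤ η := by
  obtain ⟨M, hM, hM0⟩ := ((ENNReal.tendsto_nhds_zero.1 h η hη).and (eventually_ge_atTop 0)).exists
  refine ⟨M, hM0, fun n => le_trans ?_ ((le_iSup _ n).trans hM)⟩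
  have hms : MeasurableSet {x : ℝ | M < |x|} := measurableSet_lt measurable_const measurable_id.abs
  rw [← lintegral_indicator hms, lintegral_map (measurable_enorm.indicator hms) (by fun_prop)]
  refine lintegral_mono fun w => ?_
  have he : ‖w.1‖ₑ ^ 2 = ENNReal.ofReal (‖w.1‖ ^ 2) := by
    rw [← ofReal_norm, ENNReal.ofReal_pow (norm_nonneg _)]
  by_cases hw : M < |‖w.1‖ ^ 2|
  · rw [Set.indicator_of_mem (by exact hw), Real.enorm_eq_ofReal_abs, abs_of_nonneg (sq_nonneg _),
      he]
    exact tsub_le_self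
  · rw [Set.indicator_of_notMem (by exact hw), he]
    rw [abs_of_nonneg (sq_nonneg _), not_lt] at hw
    exact (tsub_eq_zero_of_le (ENNReal.ofReal_le_ofReal hw)).le

end Bounds

/-! ### Conditioning on an independent σ-algebra -/

section Independent

variable {Ω : Type*} {m mΩ : MeasurableSpace Ω} {P : Measure Ω} [IsProbabilityMeasure P]

theorem condVar_of_indep (hm : m ≤ mΩ) {R : Ω → ℝ} (hR : Measurable R)
    (h : Indep (MeasurableSpace.comap R inferInstance) m P) :
    condVar m R P =ᵐ[P] fun _ => Var[R; P] := by
  have hR' : Measurable[MeasurableSpace.comap R inferInstance] R := comap_measurable R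
  have h1 := condExp_indep_eq hR.comap_le hm hR'.stronglyMeasurable h
  have h2 : (fun ω => (R ω - (P[R | m]) ω) ^ 2) =ᵐ[P] fun ω => (R ω - ∫ ω', R ω' ∂P) ^ 2 := by
    filter_upwards [h1] with ω hω
    rw [hω]
  have h3 := condExp_indep_eq hR.comap_le hm
    ((hR'.sub_const (∫ ω', R ω' ∂P)).pow_const 2).stronglyMeasurable h
  rw [variance_eq_integral hR.aemeasurable]
  exact (condExp_congr_ae h2).trans h3

theorem oneStep_standard_normal (hm : m ≤ mΩ) {ε : Ω → ℝ} (hε : Measurable ε)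
    (hlaw : P.map ε = gaussianReal 0 1)
    (h : Indep (MeasurableSpace.comap ε inferInstance) m P) (c : ℝ) :
    ∀ᵐ ω ∂P, oneStep P m c ε ω = c := by
  have h0 : ∫ ω, ε ω ∂P = 0 := by
    have : ∫ x, x ∂(P.map ε) = ∫ ω, ε ω ∂P := integral_map hε.aemeasurable (by fun_prop)
    rw [← this, hlaw, integral_id_gaussianReal]
  have h1 : Var[ε; P] = 1 := by
    have : Var[id; P.map ε] = Var[ε; P] := variance_id_map hε.aemeasurable
    rw [← this, hlaw, variance_id_gaussianReal]
    simp
  have hε' : Measurable[MeasurableSpace.comap ε inferInstance] ε := comap_measurable ε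
  filter_upwards [condExp_indep_eq hε.comap_le hm hε'.stronglyMeasurable h,
    condVar_of_indep hm hε h] with ω h2 h3
  rw [oneStep, h2, h3, h0, h1]
  simp

end Independent

/-! ### Gaussian regression -/

section Gaussian

variable {Ω : Type*} {mΩ : MeasurableSpace Ω} {P : Measure Ω} [IsProbabilityMeasure P]
  {F : Type*} [NormedAddCommGroup F] [NormedSpace ℝ F] [FiniteDimensional ℝ F]

/-- Linear regression of a square integrable random variable on a random vector. -/
theorem exists_covariance_sub_eq_zero {U : Ω → F} {V : Ω → ℝ} (hU : MemLp U 2 P)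
    (hV : MemLp V 2 P) :
    ∃ A : StrongDual ℝ F, ∀ B : StrongDual ℝ F,
      cov[fun ω => V ω - A (U ω), fun ω => B (U ω); P] = 0 := by
  have := FiniteDimensional.complete ℝ F
  have hU1 := hU.integrable one_le_two
  have hV1 := hV.integrable one_le_two
  have hW : MemLp (fun ω => U ω - ∫ ω', U ω' ∂P) 2 P := hU.sub (memLp_const _)
  have hV0 : MemLp (fun ω => V ω - ∫ ω', V ω' ∂P) 2 P := hV.sub (memLp_const _)
  let Φ : StrongDual ℝ F →ₗ[ℝ] Lp ℝ 2 P :=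
    { toFun := fun B => B.compLp hW.toLp
      map_add' := fun B B' => ContinuousLinearMap.add_compLp B B' _
      map_smul' := fun a B => ContinuousLinearMap.smul_compLp a B _ }
  have hΦ : ∀ B, Φ B =ᵐ[P] fun ω => B (U ω - ∫ ω', U ω' ∂P) := fun B => by
    filter_upwards [B.coeFn_compLp hW.toLp, hW.coeFn_toLp] with ω h1 h2
    simp only [Φ, LinearMap.coe_mk, AddHom.coe_mk]
    rw [h1, h2]
  -- The centred functionals of `U` form a finite-dimensional subspace of `L²`, so the centred `V`
  -- projects orthogonally onto it; `A` represents the projection.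
  obtain ⟨A, hA⟩ := LinearMap.mem_range.1
    ((LinearMap.range Φ).starProjection_apply_mem hV0.toLp)
  refine ⟨A, fun B => ?_⟩
  have horth := Submodule.inner_left_of_mem_orthogonal (LinearMap.mem_range_self Φ B)
    ((LinearMap.range Φ).sub_starProjection_mem_orthogonal hV0.toLp)
  rw [← hA, L2.inner_def] at horth
  rw [covariance, ← horth]
  refine integral_congr_ae ?_
  filter_upwards [Lp.coeFn_sub hV0.toLp (Φ A), hV0.coeFn_toLp, hΦ A, hΦ B] with ω h1 h2 h3 h4
  rw [h1, Pi.sub_apply, h2, h3, h4, integral_sub hV1 (A.integrable_comp hU1),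
    A.integral_comp_comm hU1, B.integral_comp_comm hU1]
  rw [real_inner_eq_re_inner ℝ, RCLike.inner_apply, RCLike.re_to_real, conj_trivial]
  simp only [map_sub]
  ring

variable [MeasurableSpace F] [BorelSpace F]

/-- In a jointly Gaussian model, conditional expectations are affine and conditional variances are
constant. -/
theorem exists_condExp_eq_affine {U : Ω → F} {V : Ω → ℝ} (hU : Measurable U) (hV : Measurable V)
    (h : HasGaussianLaw (fun ω => (V ω, U ω)) P) :
    ∃ (A : StrongDual ℝ F) (b v : ℝ),
      P[V | MeasurableSpace.comap U inferInstance] =ᵐ[P] (fun ω => A (U ω) + b) ∧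
      condVar (MeasurableSpace.comap U inferInstance) V P =ᵐ[P] fun _ => v := by
  have := FiniteDimensional.complete ℝ F
  have := FiniteDimensional.proper ℝ F
  obtain ⟨A, hA⟩ := exists_covariance_sub_eq_zero h.snd.memLp_two h.fst.memLp_two
  set R : Ω → ℝ := fun ω => V ω - A (U ω) with hRdef
  have hRm : Measurable R := hV.sub (A.continuous.measurable.comp hU)
  have hRU : HasGaussianLaw (fun ω => (R ω, U ω)) P :=
    h.map_fun (((ContinuousLinearMap.fst ℝ ℝ F) - A ∘L (ContinuousLinearMap.snd ℝ ℝ F)).prod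
      (ContinuousLinearMap.snd ℝ ℝ F))
  -- The residual is jointly Gaussian with `U` and uncorrelated with it, hence independent. A
  -- functional on `ℝ` is multiplication by `L 1`.
  have hind : IndepFun R U P := hRU.indepFun_of_covariance_strongDual fun L B => by
    have hL : L ∘ R = fun ω => L 1 * R ω := by
      funext ω
      have := L.map_smul (R ω) 1
      simp only [smul_eq_mul, mul_one] at this
      simp [this, mul_comm]
    rw [hL, covariance_const_mul_left]
    exact mul_eq_zero_of_right _ (hA B)
  have hind' : Indep (MeasurableSpace.comap R inferInstance)
    (MeasurableSpace.comap U inferInstance) P := hind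
  have hRi : Integrable R P := hRU.fst.memLp_two.integrable one_le_two
  have hAi : Integrable (fun ω => A (U ω)) P := A.integrable_comp h.snd.integrable
  have hR' : Measurable[MeasurableSpace.comap R inferInstance] R := comap_measurable R
  have hAU : Measurable[MeasurableSpace.comap U inferInstance] fun ω => A (U ω) :=
    A.continuous.measurable.comp (comap_measurable U)
  have h1 := condExp_indep_eq hRm.comap_le hU.comap_le hR'.stronglyMeasurable hind'
  have h2 : V = (fun ω => A (U ω)) + R := by
    funext ω
    simp [hRdef]
  have h3 : P[V | MeasurableSpace.comap U inferInstance] =ᵐ[P]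
      fun ω => A (U ω) + ∫ ω', R ω' ∂P := by
    rw [h2]
    filter_upwards [condExp_add hAi hRi (MeasurableSpace.comap U inferInstance), h1] with ω h4 h5
    rw [h4, Pi.add_apply, h5, condExp_of_stronglyMeasurable hU.comap_le hAU.stronglyMeasurable hAi]
  -- `V` and `R` have the same deviation from their conditional means, as `A (U ω)` cancels.
  refine ⟨A, _, Var[R; P], h3, EventuallyEq.trans (condExp_congr_ae ?_)
    (condVar_of_indep hU.comap_le hRm hind')⟩
  filter_upwards [h3, h1] with ω h4 h5
  have h6 : V ω = A (U ω) + R ω := congrFun h2 ω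
  simp only [Pi.pow_apply, Pi.sub_apply, h4, h5, h6]
  ring

end Gaussian

/-! ### Conditional law of total variance -/

section Tower

variable {Ω : Type*} {m m' mΩ : MeasurableSpace Ω} {P : Measure Ω} [IsProbabilityMeasure P]

theorem condExp_add_const (hm : m ≤ mΩ) {W : Ω → ℝ} (hW : Integrable W P) (K : ℝ) :
    P[fun ω => W ω + K | m] =ᵐ[P] fun ω => (P[W | m]) ω + K := by
  filter_upwards [condExp_add hW (integrable_const K) m] with ω h
  refine h.trans ?_
  rw [Pi.add_apply, condExp_const hm]

theorem condVar_add_const (hm : m ≤ mΩ) {W : Ω → ℝ} (hW : Integrable W P) (K : ℝ) :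
    condVar m (fun ω => W ω + K) P =ᵐ[P] condVar m W P := by
  refine condExp_congr_ae ?_
  filter_upwards [condExp_add_const hm hW K] with ω h
  simp only [Pi.pow_apply, Pi.sub_apply, h]
  ring

/-- The law of total variance, conditionally, for a constant inner conditional variance. -/
theorem condVar_condExp_of_const (hmm : m ≤ m') (hm' : m' ≤ mΩ) {S : Ω → ℝ} (hS : MemLp S 2 P)
    {v' : ℝ} (hv' : condVar m' S P =ᵐ[P] fun _ => v') :
    condVar m (P[S | m']) P =ᵐ[P] fun ω => condVar m S P ω - v' := by
  have hm := hmm.trans hm'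
  have hM : MemLp (P[S | m']) 2 P := hS.condExp one_le_two
  have hsq : (P[S | m']) ^ 2 =ᵐ[P] fun ω => (P[S ^ 2 | m']) ω + -v' := by
    filter_upwards [condVar_ae_eq_condExp_sq_sub_sq_condExp hm' hS, hv'] with ω h1 h2
    rw [h2, Pi.sub_apply] at h1
    linarith
  filter_upwards [condVar_ae_eq_condExp_sq_sub_sq_condExp hm hM,
    condVar_ae_eq_condExp_sq_sub_sq_condExp hm hS,
    condExp_condExp_of_le (f := S) hmm hm', condExp_condExp_of_le (f := S ^ 2) hmm hm',
    condExp_congr_ae (m := m) hsq, condExp_add_const hm integrable_condExp (-v')]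
    with ω h1 h2 h3 h4 h5 h6
  rw [h1, h2, Pi.sub_apply, Pi.sub_apply, Pi.pow_apply, Pi.pow_apply, h3, h5, h6, h4]
  ring

/-- The form "conditional expectation of `S` plus a constant" survives a valuation step: the tower
property handles the mean, total variance the spread. -/
theorem oneStep_condExp_add_const (hmm : m ≤ m') (hm' : m' ≤ mΩ) {S : Ω → ℝ} (hS : MemLp S 2 P)
    {v v' : ℝ} (hv : condVar m S P =ᵐ[P] fun _ => v) (hv' : condVar m' S P =ᵐ[P] fun _ => v')
    (c K : ℝ) :
    oneStep P m c (fun ω => (P[S | m']) ω + K) =ᵐ[P]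
      fun ω => (P[S | m]) ω + (K + c * √(v - v')) := by
  have hm := hmm.trans hm'
  filter_upwards [condExp_add_const hm (integrable_condExp (m := m') (f := S)) K,
    condVar_add_const hm (integrable_condExp (m := m') (f := S)) K,
    condVar_condExp_of_const hmm hm' hS hv', condExp_condExp_of_le (f := S) hmm hm', hv]
    with ω h1 h2 h3 h4 h5
  rw [oneStep, h1, h2, h3, h4, h5]
  ring

/-- The difference `v - v'` is itself a conditional variance, that of `P[S | m']`. -/
theorem const_condVar_anti (hmm : m ≤ m') (hm' : m' ≤ mΩ) {S : Ω → ℝ} (hS : MemLp S 2 P)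
    {v v' : ℝ} (hv : condVar m S P =ᵐ[P] fun _ => v) (hv' : condVar m' S P =ᵐ[P] fun _ => v') :
    v' ≤ v := by
  obtain ⟨ω, h1, h2, h3⟩ := ((condVar_condExp_of_const hmm hm' hS hv').and
    ((condVar_nonneg_ae (m := m) (P[S | m'])).and hv)).exists
  rw [Pi.zero_apply, h1] at h2
  simp only [h3] at h2
  linarith

end Tower

/-! ### The value process of a Gaussian model -/

section GaussianValue

variable {T d : ℕ} {Ω : Type*} {mΩ : MeasurableSpace Ω} {P : Measure Ω}

/-- The sum of the payments strictly after time `t`. -/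
def remaining (t : ℕ) (w : Path T d) : ℝ := ∑ u with t ≤ (u : Fin T).val, w.1 u

theorem remaining_eq_sum_Ici (i : Fin T) (w : Path T d) :
    remaining (i : ℕ) w = ∑ u ∈ Finset.Ici i, w.1 u := by
  refine Finset.sum_congr ?_ fun _ _ => rfl
  ext u
  simp

theorem remaining_eq_add (i : Fin T) (w : Path T d) :
    remaining (i : ℕ) w = w.1 i + remaining (i + 1) w := by
  have : Finset.univ.filter (fun u : Fin T => (i : ℕ) ≤ u) =
      insert i (Finset.univ.filter (fun u : Fin T => (i : ℕ) + 1 ≤ u)) := by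
    ext u
    simp only [Finset.mem_filter_univ, Finset.mem_insert, Fin.ext_iff]
    omega
  unfold remaining
  rw [this, Finset.sum_insert (by simp)]

theorem remaining_last (w : Path T d) : remaining T w = 0 := by
  refine Finset.sum_eq_zero fun u hu => ?_
  rw [Finset.mem_filter_univ] at hu
  omega

/-- `remaining t` as a continuous linear functional. -/
noncomputable def remainingCLM (t : ℕ) : StrongDual ℝ (Path T d) :=
  ∑ u with t ≤ (u : Fin T).val,
    (EuclideanSpace.proj (𝕜 := ℝ) u) ∘L
      (ContinuousLinearMap.fst ℝ (EuclideanSpace ℝ (Fin T)) (Fin T → EuclideanSpace ℝ (Fin d)))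

theorem remainingCLM_apply (t : ℕ) (w : Path T d) : remainingCLM t w = remaining t w := by
  simp [remainingCLM, remaining]

/-- `past t` as a continuous linear map. -/
noncomputable def pastCLM (t : ℕ) : Path T d →L[ℝ] Past T d t where
  toFun := past t
  map_add' _ _ := rfl
  map_smul' _ _ := rfl
  cont := continuous_past t

theorem measurable_remaining (t : ℕ) : Measurable (remaining t : Path T d → ℝ) := by
  unfold remaining
  fun_prop

variable {Z : Ω → Path T d}

theorem memLp_remaining (hg : HasGaussianLaw Z P) (t : ℕ) :
    MemLp (fun ω => remaining t (Z ω)) 2 P := by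
  simpa only [remainingCLM_apply] using (hg.map_fun (remainingCLM t)).memLp_two

variable [IsProbabilityMeasure P]

theorem exists_condExp_remaining (hZ : Measurable Z) (hg : HasGaussianLaw Z P) (s t : ℕ) :
    ∃ (A : StrongDual ℝ (Past T d t)) (b v : ℝ),
      P[fun ω => remaining s (Z ω) | info Z t] =ᵐ[P] (fun ω => A (past t (Z ω)) + b) ∧
      condVar (info Z t) (fun ω => remaining s (Z ω)) P =ᵐ[P] fun _ => v := by
  refine exists_condExp_eq_affine (U := fun ω => past t (Z ω)) (by fun_prop)
    ((measurable_remaining s).comp hZ) ?_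
  have := hg.map_fun ((remainingCLM s).prod (pastCLM t))
  simpa only [ContinuousLinearMap.prod_apply, remainingCLM_apply] using! this

/-- The decreases in conditional variance are nonnegative constants, and the value process is
affine in the conditional expectation of the remaining payments. -/
theorem exists_value_eq_condExp_add (hZ : Measurable Z) (hg : HasGaussianLaw Z P)
    (c : Fin T → ℝ) :
    ∃ δ : Fin T → ℝ, (∀ i, 0 ≤ δ i) ∧ (∀ i, varDrop P Z i =ᵐ[P] fun _ => δ i) ∧
      ∀ t ≤ T, value P c Z t =ᵐ[P] fun ω => (P[fun ω' => remaining t (Z ω') | info Z t]) ω +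
        ∑ i with t ≤ (i : Fin T).val, c i * √(δ i) := by
  choose A b v hA hv using fun s t => exists_condExp_remaining hZ hg s t
  have hSS : ∀ i : Fin T, (fun ω' => ∑ u ∈ Finset.Ici i, (Z ω').1 u) =
      fun ω' => remaining i (Z ω') := fun i => by
    funext ω
    rw [remaining_eq_sum_Ici]
  -- `v s t` is the constant conditional variance, given the past up to `t`, of the payments after
  -- time `s`.
  refine ⟨fun i => v i i - v i (i + 1), fun i => ?_, fun i => ?_, fun t ht => ?_⟩
  · exact sub_nonneg.2 (const_condVar_anti (info_mono Z (Nat.le_succ _)) (info_le hZ _)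
      (memLp_remaining hg i) (hv i i) (hv i (i + 1)))
  · unfold varDrop
    rw [hSS]
    filter_upwards [hv i i, hv i (i + 1)] with ω h1 h2
    rw [h1, h2]
  · have hX : MemLp (fun ω => (Z ω).1) 2 P := (hg.map_fun (ContinuousLinearMap.fst ℝ
      (EuclideanSpace ℝ (Fin T)) (Fin T → EuclideanSpace ℝ (Fin d)))).memLp_two
    induction ht using Nat.decreasingInduction with
    | self =>
      rw [value_last]
      have h1 : (fun ω' => remaining T (Z ω')) = 0 := funext fun ω => remaining_last _
      rw [h1, condExp_zero]
      refine ae_of_all _ fun ω => ?_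
      simp only [Pi.zero_apply, zero_add]
      refine (Finset.sum_eq_zero fun u hu => ?_).symm
      rw [Finset.mem_filter_univ] at hu
      omega
    | of_succ t ht ih =>
      let i : Fin T := ⟨t, ht⟩
      have h := value_of_lt P c Z i
      simp only [i] at h
      rw [h]
      have hfilter : Finset.univ.filter (fun u : Fin T => t ≤ u) =
          insert i (Finset.univ.filter (fun u : Fin T => t + 1 ≤ u)) := by
        ext u
        simp only [Finset.mem_filter_univ, Finset.mem_insert, Fin.ext_iff, i]
        omega
      rw [hfilter, Finset.sum_insert (by simp [i])]
      have hXi : Integrable (fun ω => (Z ω).1 i) P := (memLp_coord hX i).integrable one_le_two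
      have hXc : P[fun ω => (Z ω).1 i | info Z (t + 1)] = fun ω => (Z ω).1 i :=
        condExp_of_stronglyMeasurable (info_le hZ _)
          (measurable_coord_info Z (Nat.lt_succ_self t)).stronglyMeasurable hXi
      -- The coordinate `i` is paid at time `t + 1` and is known then, so it can be moved into the
      -- conditional expectation.
      have hW : (fun ω => (Z ω).1 i + value P c Z (t + 1) ω) =ᵐ[P]
          fun ω => (P[fun ω' => remaining t (Z ω') | info Z (t + 1)]) ω +
            ∑ u with t + 1 ≤ (u : Fin T).val, c u * √(v u u - v u (u + 1)) := by
        have hadd : (fun ω' => remaining t (Z ω')) =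
            (fun ω' => (Z ω').1 i) + fun ω' => remaining (t + 1) (Z ω') :=
          funext fun ω => remaining_eq_add i (Z ω)
        rw [hadd]
        filter_upwards [ih, condExp_add hXi ((memLp_remaining hg (t + 1)).integrable one_le_two)
          (info Z (t + 1))] with ω h1 h2
        rw [h1, h2, Pi.add_apply, hXc]
        ring
      refine (oneStep_congr hW).trans ?_
      filter_upwards [oneStep_condExp_add_const (info_mono Z (Nat.le_succ t)) (info_le hZ _)
        (memLp_remaining hg t) (hv t t) (hv t (t + 1)) (c i) _] with ω hω
      rw [hω, add_comm (c i * _)]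

/-- Affine functions of the past are continuous everywhere; the induction needs this of the limit
values. -/
theorem exists_continuous_value_eq (hZ : Measurable Z) (hg : HasGaussianLaw Z P)
    (c : Fin T → ℝ) :
    ∃ a : ∀ t, Past T d t → ℝ, (∀ t, Continuous (a t)) ∧ a T = 0 ∧
      ∀ t ≤ T, value P c Z t =ᵐ[P] fun ω => a t (past t (Z ω)) := by
  obtain ⟨δ, -, -, hval⟩ := exists_value_eq_condExp_add hZ hg c
  choose A b v hA hv using fun t => exists_condExp_remaining hZ hg t t
  let a : ∀ t, Past T d t → ℝ := fun t => if t < T then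
    fun z => A t z + b t + ∑ i with t ≤ (i : Fin T).val, c i * √(δ i) else 0
  refine ⟨a, fun t => ?_, if_neg (lt_irrefl T), fun t ht => ?_⟩
  · by_cases h : t < T
    · simp only [a, if_pos h]
      fun_prop
    · simp only [a, if_neg h]
      exact continuous_const
  · rcases ht.eq_or_lt with rfl | h
    · rw [value_last]
      simp only [a, if_neg (lt_irrefl t)]
      rfl
    · simp only [a, if_pos h]
      filter_upwards [hval t ht, hA t] with ω h1 h2
      rw [h1, h2]

end GaussianValue

/-! ### Sequences in supports and locally uniform convergence -/

section Sequences

/-- The conditional hypotheses concern full sequences of support points, while the induction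
produces subsequences; the gaps are filled from `y`. -/
theorem exists_seq_extension {α : Type*} [TopologicalSpace α] {S : ℕ → Set α} {z : α}
    {n : ℕ → ℕ} (hn : StrictMono n) {x : ℕ → α} (hx : ∀ k, x k ∈ S (n k))
    (hxz : Tendsto x atTop (𝓝 z)) {y : ℕ → α} (hy : ∀ m, y m ∈ S m)
    (hyz : Tendsto y atTop (𝓝 z)) :
    ∃ u : ℕ → α, (∀ m, u m ∈ S m) ∧ Tendsto u atTop (𝓝 z) ∧ ∀ k, u (n k) = x k := by
  classical
  let u : ℕ → α := fun m => if h : ∃ k, n k = m then x h.choose else y m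
  have hu : ∀ k, u (n k) = x k := fun k => by
    have h : ∃ l, n l = n k := ⟨k, rfl⟩
    simp only [u, dif_pos h]
    rw [hn.injective h.choose_spec]
  have hu' : ∀ m, (¬∃ k, n k = m) → u m = y m := fun m h => dif_neg h
  refine ⟨u, fun m => ?_, fun U hU => ?_, hu⟩
  · by_cases h : ∃ k, n k = m
    · obtain ⟨k, rfl⟩ := h
      rw [hu]
      exact hx k
    · rw [hu' m h]
      exact hy m
  · obtain ⟨K, hK⟩ := (hxz.eventually_mem hU).exists_forall_of_atTop
    rw [mem_map]
    filter_upwards [hyz.eventually_mem hU, eventually_ge_atTop (n K)] with m h1 h2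
    change u m ∈ U
    by_cases h : ∃ k, n k = m
    · obtain ⟨k, rfl⟩ := h
      rw [hu]
      exact hK k (hn.le_iff_le.1 h2)
    · rw [hu' m h]
      exact h1

/-- Points of the support of a weak limit are limits of points of the supports. -/
theorem exists_seq_mem_support {α : Type*} [MetricSpace α] [SecondCountableTopology α]
    [MeasurableSpace α] [BorelSpace α] {νs : ℕ → ProbabilityMeasure α} {ν : ProbabilityMeasure α}
    (h : Tendsto νs atTop (𝓝 ν)) {z : α} (hz : z ∈ (ν : Measure α).support) :
    ∃ y : ℕ → α, (∀ n, y n ∈ (νs n : Measure α).support) ∧ Tendsto y atTop (𝓝 z) := by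
  have hne : ∀ n, (νs n : Measure α).support.Nonempty := fun n =>
    Measure.nonempty_support (IsProbabilityMeasure.ne_zero _)
  have hch : ∀ n, ∃ y ∈ (νs n : Measure α).support,
      dist z y < Metric.infDist z (νs n : Measure α).support + 1 / ((n : ℝ) + 1) := fun n =>
    (Metric.infDist_lt_iff (hne n)).1 (lt_add_of_pos_right _ (by positivity))
  choose y hy hyd using hch
  have hlim : Tendsto (fun n => Metric.infDist z (νs n : Measure α).support) atTop (𝓝 0) := by
    rw [Metric.tendsto_atTop]
    intro ε hε
    have hpos : 0 < (ν : Measure α) (Metric.ball z ε) :=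
      (Measure.mem_support_iff_forall z).1 hz _ (Metric.ball_mem_nhds z hε)
    obtain ⟨N, hN⟩ := (eventually_lt_of_lt_liminf (hpos.trans_le
      (ProbabilityMeasure.le_liminf_measure_open_of_tendsto h
        Metric.isOpen_ball))).exists_forall_of_atTop
    refine ⟨N, fun n hn => ?_⟩
    obtain ⟨x, hx, hxs⟩ := Measure.nonempty_inter_support_of_pos (hN n hn)
    rw [Real.dist_eq, sub_zero, abs_of_nonneg Metric.infDist_nonneg]
    exact (Metric.infDist_le_dist_of_mem hxs).trans_lt (Metric.mem_ball'.1 hx)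
  refine ⟨y, hy, tendsto_iff_dist_tendsto_zero.2 ?_⟩
  have hsum := hlim.add (tendsto_one_div_add_atTop_nhds_zero_nat (𝕜 := ℝ))
  rw [add_zero] at hsum
  refine squeeze_zero (fun _ => dist_nonneg) (fun n => ?_) hsum
  rw [dist_comm]
  exact (hyd n).le

/-- Sequential convergence along all admissible sequences is locally uniform. -/
theorem exists_isOpen_forall_abs_sub_le {α : Type*} [MetricSpace α] {f : ℕ → α → ℝ} {f₀ : α → ℝ}
    {G : ℕ → Set α} {n : ℕ → ℕ} (hn : Tendsto n atTop atTop) {z : α} (hf₀ : ContinuousAt f₀ z)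
    (h : ∀ (k : ℕ → ℕ) (x : ℕ → α), Tendsto k atTop atTop → (∀ j, x j ∈ G (k j)) →
      Tendsto x atTop (𝓝 z) → Tendsto (fun j => f (k j) (x j)) atTop (𝓝 (f₀ z)))
    {ε : ℝ} (hε : 0 < ε) :
    ∃ U, IsOpen U ∧ z ∈ U ∧ ∃ N, ∀ m ≥ N, ∀ x ∈ U, x ∈ G (n m) → |f (n m) x - f₀ x| ≤ ε := by
  -- Failure on the balls of radius `1 / (j + 1)` with indices at least `j` yields an admissible
  -- sequence that violates `h`.
  by_contra! hcon
  have hch : ∀ j : ℕ, ∃ m ≥ j, ∃ x ∈ Metric.ball z (1 / ((j : ℝ) + 1)), x ∈ G (n m) ∧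
      ε < |f (n m) x - f₀ x| := fun j =>
    hcon _ Metric.isOpen_ball (Metric.mem_ball_self (by positivity)) j
  choose m hm x hxz hxG hxε using hch
  have hx : Tendsto x atTop (𝓝 z) := tendsto_iff_dist_tendsto_zero.2
    (squeeze_zero (fun _ => dist_nonneg) (fun j => (Metric.mem_ball.1 (hxz j)).le)
      (tendsto_one_div_add_atTop_nhds_zero_nat (𝕜 := ℝ)))
  have hlim := ((h (fun j => n (m j)) x (hn.comp (tendsto_atTop_mono hm tendsto_id)) hxG hx).sub
    (hf₀.tendsto.comp hx)).abs
  rw [sub_self, abs_zero] at hlim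
  exact absurd (ge_of_tendsto' hlim fun j => (hxε j).le) (not_le.2 hε)

end Sequences

/-! ### Backward induction for the value functions -/

section Convergence

variable {T d : ℕ}

theorem unifIntegrableLaws_comp {ν : ℕ → Measure ℝ} (h : UnifIntegrableLaws ν) (n : ℕ → ℕ) :
    UnifIntegrableLaws fun k => ν (n k) :=
  tendsto_of_tendsto_of_tendsto_of_le_of_le tendsto_const_nhds h (fun _ => zero_le)
    fun _ => iSup_le fun k => le_iSup (fun m => ∫⁻ x in _, ‖x‖ₑ ∂ν m) (n k)

/-- One backward step of the convergence of value functions, along a sequence of kernels. -/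
theorem tendsto_kernelStep (c : Fin T → ℝ) (i : Fin T)
    {κ : Kernel (Past T d i) (Path T d)} [IsMarkovKernel κ]
    {κn : ℕ → ∀ t : ℕ, Kernel (Past T d t) (Path T d)} [∀ n t, IsMarkovKernel (κn n t)]
    {A : ℕ → ∀ t, Set (Past T d t)} (hA : ∀ n, ∀ t < T, A n t ⊆ towerSet (κn n) t)
    {a : Past T d (i + 1) → ℝ} (ha : Continuous a) {z : Past T d i} {G : Set (Past T d (i + 1))}
    (hG : ∀ᵐ w ∂κ z, past (i + 1) w ∈ G)
    (hnext : ∀ z' ∈ G, ∀ (k : ℕ → ℕ) (x : ℕ → Past T d (i + 1)), Tendsto k atTop atTop →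
      (∀ j, x j ∈ goodSet (κn (k j)) (A (k j)) (i + 1)) → Tendsto x atTop (𝓝 z') →
      Tendsto (fun j => pathValue c (κn (k j)) (i + 1) (x j)) atTop (𝓝 (a z')))
    {n : ℕ → ℕ} (hn : Tendsto n atTop atTop) {x : ℕ → Past T d i}
    (hx : ∀ k, x k ∈ goodSet (κn (n k)) (A (n k)) i)
    (hweak : Tendsto (β := ProbabilityMeasure (Path T d))
      (fun k => ⟨κn (n k) i (x k), inferInstance⟩) atTop (𝓝 ⟨κ z, inferInstance⟩))
    (hUI : UnifIntegrableLaws fun k => (κn (n k) i (x k)).map fun w => ‖w.1‖ ^ 2) :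
    Tendsto (fun k => pathValue c (κn (n k)) i (x k)) atTop
      (𝓝 (kernelStep κ (c i) (fun w => w.1 i + a (past (i + 1) w)) z)) := by
  obtain ⟨C, hC⟩ := exists_enorm_sq_pathValue_le (d := d) c (t := i + 1) i.2
  have hmom := tendsto_integral_and_integral_sq hweak
    (g := fun k w => w.1 i + pathValue c (κn (n k)) (i + 1) (past (i + 1) w))
    (g₀ := fun w => w.1 i + a (past (i + 1) w))
    (fun k => (measurable_coord i).add
      ((measurable_pathValue c (κn (n k)) _).comp (measurable_past _)))
    (by fun_prop)
    (D := fun k => {w | past (i + 1) w ∈ goodSet (κn (n k)) (A (n k)) (i + 1)})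
    (fun k => ae_past_mem_goodSet i.2 (hx k)) ?_ ?_
  · simp only [pathValue_of_lt]
    exact hmom.1.add ((((hmom.2.sub (hmom.1.pow 2)).sqrt).const_mul (c i)))
  · intro ε hε
    filter_upwards [hG] with w hw
    obtain ⟨U, hU, hwU, N, hN⟩ := exists_isOpen_forall_abs_sub_le
      (f := fun m => pathValue c (κn m) (i + 1))
      (G := fun m => goodSet (κn m) (A m) (i + 1)) hn ha.continuousAt (hnext _ hw) hε
    refine ⟨past (i + 1) ⁻¹' U, hU.preimage (continuous_past _), hwU, N, fun k hk w' hw' hD => ?_⟩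
    rw [add_sub_add_left_eq_sub]
    exact hN k hk _ hw' hD
  · intro η hη
    have hη' : 0 < ENNReal.ofReal (η / (4 * (1 + C))) := by
      rw [ENNReal.ofReal_pos]
      positivity
    obtain ⟨M, hM, hMk⟩ := exists_lintegral_sub_le_of_unifIntegrableLaws hUI hη'
    have hnn : 0 ≤ 4 * (1 + (C : ℝ)) * M := by positivity
    -- Since `r ≥ 1`, `r ^ 2 ≥ r ≥ 4 * (1 + C) * M`.
    refine ⟨1 + 4 * (1 + C) * M, by linarith, fun k => ?_⟩
    refine (lintegral_tail_coord_add_pathValue_le c i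
      (hA (n k) i i.2 (goodSet_subset _ _ (hx k))) ?_ hM (by nlinarith)).trans ?_
    · filter_upwards [ae_past_mem_goodSet i.2 (hx k)] with w hw
      exact hC (κn (n k)) (A (n k)) (hA (n k)) _ hw
    · refine (mul_le_mul' le_rfl (hMk k)).trans (le_of_eq ?_)
      rw [← ENNReal.ofReal_coe_nnreal, ← ENNReal.ofReal_mul (NNReal.coe_nonneg _)]
      congr 1
      push_cast
      field_simp

/-- Convergence of the value functions along sequences of good initial segments. -/
theorem tendsto_pathValue (c : Fin T → ℝ)
    {κ : ∀ t : ℕ, Kernel (Past T d t) (Path T d)} [∀ t, IsMarkovKernel (κ t)]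
    {κn : ℕ → ∀ t : ℕ, Kernel (Past T d t) (Path T d)} [∀ n t, IsMarkovKernel (κn n t)]
    {S : ℕ → ∀ t, Set (Past T d t)} {S₀ : ∀ t, Set (Past T d t)}
    (hS : ∀ t ≤ T, ∀ z ∈ S₀ t, ∃ y : ℕ → Past T d t, (∀ n, y n ∈ S n t) ∧ Tendsto y atTop (𝓝 z))
    (hcond : ∀ t ≤ T, ∀ (zn : ℕ → Past T d t) (z : Past T d t), (∀ n, zn n ∈ S n t) → z ∈ S₀ t →
      Tendsto zn atTop (𝓝 z) →
      Tendsto (β := ProbabilityMeasure (Path T d))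
        (fun n => ⟨κn n t (zn n), inferInstance⟩) atTop (𝓝 ⟨κ t z, inferInstance⟩) ∧
      UnifIntegrableLaws fun n => (κn n t (zn n)).map fun w => ‖w.1‖ ^ 2)
    {a : ∀ t, Past T d t → ℝ} (ha : ∀ t, Continuous (a t)) (haT : a T = 0) {t : ℕ} (ht : t ≤ T) :
    ∀ z ∈ goodSet κ (fun s => {z | z ∈ S₀ s ∧ ∀ h : s < T, a s z = kernelStep (κ s) (c ⟨s, h⟩)
        (fun w => w.1 ⟨s, h⟩ + a (s + 1) (past (s + 1) w)) z}) t,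
      ∀ (n : ℕ → ℕ) (x : ℕ → Past T d t), Tendsto n atTop atTop →
        (∀ k, x k ∈ goodSet (κn (n k)) (fun s => S (n k) s ∩ towerSet (κn (n k)) s) t) →
        Tendsto x atTop (𝓝 z) →
        Tendsto (fun k => pathValue c (κn (n k)) t (x k)) atTop (𝓝 (a t z)) := by
  induction ht using Nat.decreasingInduction with
  | self =>
    intro z _ n x _ _ _
    simp only [pathValue_of_le c _ le_rfl, haT, Pi.zero_apply]
    exact tendsto_const_nhds
  | of_succ t ht ih =>
    intro z hz n x hn hx hxz
    have hz' := goodSet_subset _ _ hz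
    rw [hz'.2 ht]
    -- The indices only tend to infinity and may repeat. Along a strictly increasing subsequence the
    -- points extend to a full sequence of support points, to which `hcond` applies.
    refine tendsto_of_subseq_tendsto fun ns hns => ?_
    obtain ⟨ms, hms, hmono⟩ := strictMono_subseq_of_tendsto_atTop (hn.comp hns)
    refine ⟨ms, ?_⟩
    have hsub : Tendsto (fun k => ns (ms k)) atTop atTop := hns.comp hms.tendsto_atTop
    obtain ⟨y, hyS, hyz⟩ := hS t (Nat.le_of_lt ht) z hz'.1
    obtain ⟨u, huS, huz, hux⟩ := exists_seq_extension (S := fun m => S m t) hmono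
      (x := fun k => x (ns (ms k))) (fun k => (goodSet_subset _ _ (hx (ns (ms k)))).1)
      (hxz.comp hsub) hyS hyz
    obtain ⟨hweak, hUI⟩ := hcond t (Nat.le_of_lt ht) u z huS hz'.1 huz
    have hweak' := hweak.comp hmono.tendsto_atTop
    have hUI' := unifIntegrableLaws_comp hUI ((n ∘ ns) ∘ ms)
    refine tendsto_kernelStep c ⟨t, ht⟩ (κ := κ t)
      (A := fun m s => S m s ∩ towerSet (κn m) s) (fun _ _ _ => Set.inter_subset_right)
      (ha (t + 1)) (ae_past_mem_goodSet ht hz) ih (hn.comp hsub)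
      (fun k => hx (ns (ms k))) ?_ ?_
    · refine hweak'.congr fun k => Subtype.ext ?_
      simp only [Function.comp_apply] at hux ⊢
      exact congrArg _ (hux k)
    · simp only [Function.comp_apply] at hux hUI' ⊢
      simpa only [hux] using hUI'

end Convergence

/-! ### Time zero and assembly of the convergence -/

section Model

variable {T d : ℕ} {Ω : Type*} {mΩ : MeasurableSpace Ω} {P : Measure Ω} [IsProbabilityMeasure P]

theorem past_zero_eq (z z' : Past T d 0) : z = z' :=
  funext fun s => absurd s.2 (Nat.not_lt_zero _)

theorem memLp_fst_of_unifIntegrableLaws {Z : ℕ → Ω → Path T d} (hZ : ∀ n, Measurable (Z n))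
    (h : UnifIntegrableLaws fun n => (P.map (Z n)).map fun w => ‖w.1‖ ^ 2) (n : ℕ) :
    MemLp (fun ω => (Z n ω).1) 2 P := by
  obtain ⟨M, -, hM⟩ := exists_lintegral_sub_le_of_unifIntegrableLaws h one_pos
  have hPn : IsProbabilityMeasure (P.map (Z n)) :=
    Measure.isProbabilityMeasure_map (hZ n).aemeasurable
  have hfin : ∫⁻ w, ‖w.1‖ₑ ^ 2 ∂P.map (Z n) < ∞ := by
    calc ∫⁻ w, ‖w.1‖ₑ ^ 2 ∂P.map (Z n)
        ≤ ∫⁻ w, ((‖w.1‖ₑ ^ 2 - ENNReal.ofReal M) + ENNReal.ofReal M) ∂P.map (Z n) :=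
          lintegral_mono fun w => le_tsub_add
      _ = ∫⁻ w, (‖w.1‖ₑ ^ 2 - ENNReal.ofReal M) ∂P.map (Z n) + ENNReal.ofReal M := by
          rw [lintegral_add_right _ measurable_const, lintegral_const, measure_univ, mul_one]
      _ ≤ 1 + ENNReal.ofReal M := by gcongr; exact hM n
      _ < ∞ := ENNReal.add_lt_top.2 ⟨ENNReal.one_lt_top, ENNReal.ofReal_lt_top⟩
  rw [lintegral_map measurable_enorm_sq (hZ n)] at hfin
  refine ⟨(hZ n).fst.aestronglyMeasurable, ?_⟩
  rw [eLpNorm_lt_top_iff_lintegral_rpow_enorm_lt_top two_ne_zero ENNReal.ofNat_ne_top]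
  simpa using! hfin

/-- There is only one past at time zero, so the unconditional hypotheses become the case `t = 0` of
the conditional ones. -/
theorem hasCondDistrib_const_of_past_zero {Z : Ω → Path T d} (hZ : Measurable Z) :
    HasCondDistrib Z (fun ω => past 0 (Z ω)) (Kernel.const (Past T d 0) (P.map Z)) P := by
  have hPZ : IsProbabilityMeasure (P.map Z) := Measure.isProbabilityMeasure_map hZ.aemeasurable
  have hconst : (fun ω => past 0 (Z ω)) = fun _ => past 0 (0 : Path T d) :=
    funext fun ω => past_zero_eq _ _
  refine ⟨by fun_prop, ?_⟩
  have hp : (fun ω => (past 0 (Z ω), Z ω)) = fun ω => (past 0 (0 : Path T d), Z ω) :=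
    funext fun ω => congrArg (fun z => (z, Z ω)) (past_zero_eq _ _)
  rw [hp, hconst, Measure.compProd_const, Measure.map_const, measure_univ, one_smul,
    Measure.dirac_prod, Measure.map_map measurable_prodMk_left hZ]
  rfl

/-- Kernels on initial segments of positive length, extended to length zero by the unconditional
law. -/
theorem exists_kernel_extend_zero (κ : ∀ t : ℕ, Kernel (Past T d t) (Path T d))
    [∀ t, IsMarkovKernel (κ t)] (μ : Measure (Path T d)) [IsProbabilityMeasure μ] :
    ∃ κ' : ∀ t : ℕ, Kernel (Past T d t) (Path T d), (∀ t, IsMarkovKernel (κ' t)) ∧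
      κ' 0 = Kernel.const _ μ ∧ ∀ t, 1 ≤ t → κ' t = κ t := by
  refine ⟨fun t => match t with | 0 => Kernel.const _ μ | t + 1 => κ (t + 1), fun t => ?_, rfl,
    fun t ht => ?_⟩
  · cases t <;> infer_instance
  · cases t
    · omega
    · rfl

theorem ae_const_of_value_zero_eq {Z : Ω → Path T d} (c : Fin T → ℝ) {f : Past T d 0 → ℝ}
    (h : value P c Z 0 =ᵐ[P] fun ω => f (past 0 (Z ω))) (z : Past T d 0) (ω : Ω) :
    value P c Z 0 ω = f z := by
  obtain ⟨ω', hω'⟩ := h.exists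
  rw [value_zero_eq_const c ω ω', hω']
  exact congrArg f (past_zero_eq _ _)

theorem mem_of_ae_past_zero {Z : Ω → Path T d} (hZ : Measurable Z) {G : Set (Past T d 0)}
    (h : ∀ᵐ z ∂P.map (fun ω => past 0 (Z ω)), z ∈ G) (z : Past T d 0) : z ∈ G := by
  have : IsProbabilityMeasure (P.map fun ω => past 0 (Z ω)) :=
    Measure.isProbabilityMeasure_map (by fun_prop)
  obtain ⟨z', hz'⟩ := h.exists
  rwa [past_zero_eq z z']

/-- Convergence of the initial values, for regular conditional laws given at all times. -/
theorem tendsto_value_zero {Z : Ω → Path T d} {Zn : ℕ → Ω → Path T d} (hZ : Measurable Z)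
    (hZn : ∀ n, Measurable (Zn n))
    (hlim : TendstoInDistribution Zn atTop Z (fun _ => P) P) (hgauss : HasGaussianLaw Z P)
    (hLp : ∀ n, MemLp (fun ω => (Zn n ω).1) 2 P)
    {κ : ∀ t : ℕ, Kernel (Past T d t) (Path T d)} [∀ t, IsMarkovKernel (κ t)]
    {κn : ℕ → ∀ t : ℕ, Kernel (Past T d t) (Path T d)} [∀ n t, IsMarkovKernel (κn n t)]
    (hκ : ∀ t ≤ T, HasCondDistrib Z (fun ω => past t (Z ω)) (κ t) P)
    (hκn : ∀ n, ∀ t ≤ T, HasCondDistrib (Zn n) (fun ω => past t (Zn n ω)) (κn n t) P)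
    (hcond : ∀ t ≤ T, ∀ (zn : ℕ → Past T d t) (z : Past T d t),
      (∀ n, zn n ∈ (P.map (fun ω => past t (Zn n ω))).support) →
      z ∈ (P.map (fun ω => past t (Z ω))).support → Tendsto zn atTop (𝓝 z) →
      Tendsto (β := ProbabilityMeasure (Path T d))
        (fun n => ⟨κn n t (zn n), inferInstance⟩) atTop (𝓝 ⟨κ t z, inferInstance⟩) ∧
      UnifIntegrableLaws fun n => (κn n t (zn n)).map fun w => ‖w.1‖ ^ 2)
    (c : Fin T → ℝ) (ω : Ω) :
    Tendsto (fun n => value P c (Zn n) 0 ω) atTop (𝓝 (value P c Z 0 ω)) := by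
  have hX : MemLp (fun ω => (Z ω).1) 2 P := (hgauss.map_fun (ContinuousLinearMap.fst ℝ
    (EuclideanSpace ℝ (Fin T)) (Fin T → EuclideanSpace ℝ (Fin d)))).memLp_two
  obtain ⟨a, ha, haT, hav⟩ := exists_continuous_value_eq hZ hgauss c
  have hS : ∀ t ≤ T, ∀ z ∈ (P.map (fun ω => past t (Z ω))).support, ∃ y : ℕ → Past T d t,
      (∀ n, y n ∈ (P.map (fun ω => past t (Zn n ω))).support) ∧ Tendsto y atTop (𝓝 z) :=
    fun t _ z hz => exists_seq_mem_support (hlim.continuous_comp (continuous_past t)).tendsto hz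
  have hsupp : ∀ (W : Ω → Path T d) (t : ℕ), ∀ᵐ z ∂P.map (fun ω => past t (W ω)),
      z ∈ (P.map (fun ω => past t (W ω))).support := fun W t => Measure.support_mem_ae
  -- The continuous versions obey the kernel recursion at almost every past, both sides being
  -- versions of the same value.
  have hgood : ∀ t ≤ T, ∀ᵐ z ∂P.map (fun ω => past t (Z ω)),
      z ∈ {z | z ∈ (P.map (fun ω => past t (Z ω))).support ∧
        ∀ h : t < T, a t z = kernelStep (κ t) (c ⟨t, h⟩)
          (fun w => w.1 ⟨t, h⟩ + a (t + 1) (past (t + 1) w)) z} := fun t ht => by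
    refine (hsupp Z t).and ?_
    by_cases h : t < T
    · have hg : Measurable fun w : Path T d => w.1 ⟨t, h⟩ + a (t + 1) (past (t + 1) w) :=
        (measurable_coord _).add ((ha (t + 1)).measurable.comp (measurable_past _))
      have hW : (fun ω => (Z ω).1 ⟨t, h⟩ + value P c Z (t + 1) ω) =ᵐ[P]
          fun ω => (Z ω).1 ⟨t, h⟩ + a (t + 1) (past (t + 1) (Z ω)) := by
        filter_upwards [hav (t + 1) h] with ω hω
        rw [hω]
      have hL := ((memLp_coord hX ⟨t, h⟩).add (memLp_value hZ c hX (t := t + 1) h)).ae_eq hW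
      have hv := value_of_lt P c Z ⟨t, h⟩
      simp only at hv
      have heq : ∀ᵐ ω ∂P, a t (past t (Z ω)) = kernelStep (κ t) (c ⟨t, h⟩)
          (fun w => w.1 ⟨t, h⟩ + a (t + 1) (past (t + 1) w)) (past t (Z ω)) := by
        filter_upwards [hav t ht, oneStep_congr (m := info Z t) (c := c ⟨t, h⟩) hW,
          oneStep_info_eq_kernelStep hZ (hκ t ht) (c ⟨t, h⟩) hg hL] with ω h1 h2 h3
        rw [← h1, hv, h2, h3]
      have hset : MeasurableSet {z | a t z = kernelStep (κ t) (c ⟨t, h⟩)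
          (fun w => w.1 ⟨t, h⟩ + a (t + 1) (past (t + 1) w)) z} :=
        measurableSet_eq_fun (ha t).measurable (measurable_kernelStep _ _ hg)
      filter_upwards [(ae_map_iff (by fun_prop) hset).2 heq] with z hz _
      exact hz
    · exact ae_of_all _ fun z h' => absurd h' h
  have hgoodn : ∀ n, ∀ t ≤ T, ∀ᵐ z ∂P.map (fun ω => past t (Zn n ω)),
      z ∈ (P.map (fun ω => past t (Zn n ω))).support ∩
        towerSet (κn n) t := fun n t ht => by
    refine (hsupp (Zn n) t).and ?_
    by_cases h : t < T
    · filter_upwards [ae_lintegral_kernel_kernel (hZn n) (Nat.le_succ t) (hκn n t ht)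
        (hκn n (t + 1) h)] with z hz _
      exact hz
    · exact ae_of_all _ fun z h' => absurd h' h
  let z₀ : Past T d 0 := past 0 0
  have hlimit := tendsto_pathValue c (κ := κ) (κn := κn)
    (S := fun n t => (P.map (fun ω => past t (Zn n ω))).support)
    (S₀ := fun t => (P.map (fun ω => past t (Z ω))).support) hS hcond ha haT (Nat.zero_le T) z₀
    (mem_of_ae_past_zero hZ (ae_mem_goodSet hZ hκ hgood (Nat.zero_le T)) z₀)
    (fun n => n) (fun _ => z₀) tendsto_id
    (fun n => mem_of_ae_past_zero (hZn n)
      (ae_mem_goodSet (hZn n) (hκn n) (hgoodn n) (Nat.zero_le T)) z₀) tendsto_const_nhds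
  rw [ae_const_of_value_zero_eq c (hav 0 (Nat.zero_le T)) z₀ ω]
  refine hlimit.congr fun n => ?_
  exact (ae_const_of_value_zero_eq c
    (value_eq_pathValue (hZn n) (hκn n) c (hLp n) (Nat.zero_le T)) z₀ ω).symm

end Model

end MultiPeriod

/-! ### The main theorem -/

theorem theorem2 {Ω : Type*} [MeasurableSpace Ω] (P : Measure Ω) [IsProbabilityMeasure P]
    (T d : ℕ)
    -- the limit model `(X, Y)` and the models `(X^n, Y^n)`
    (X : Ω → EuclideanSpace ℝ (Fin T)) (Y : Ω → Fin T → EuclideanSpace ℝ (Fin d))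
    (Xn : ℕ → Ω → EuclideanSpace ℝ (Fin T)) (Yn : ℕ → Ω → Fin T → EuclideanSpace ℝ (Fin d))
    (hX : Measurable X) (hY : Measurable Y)
    (hXn : ∀ n, Measurable (Xn n)) (hYn : ∀ n, Measurable (Yn n))
    -- joint weak convergence to a Gaussian limit, uniform integrability of `‖X^n‖²`
    (hlim : TendstoInDistribution (fun n ω => (Xn n ω, Yn n ω)) atTop (fun ω => (X ω, Y ω))
      (fun _ => P) P)
    (hgauss : HasGaussianLaw (fun ω => (X ω, Y ω)) P)
    (hUI : MultiPeriod.UnifIntegrableLaws (fun n => P.map (fun ω => ‖Xn n ω‖ ^ 2)))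
    -- regular conditional laws of `(X, Y)` given `(X, Y)_{≤ t}`, the same for `(X^n, Y^n)`
    (κ : ∀ t : ℕ, Kernel (MultiPeriod.Past T d t) (MultiPeriod.Path T d))
    [∀ t, IsMarkovKernel (κ t)]
    (κn : ℕ → ∀ t : ℕ, Kernel (MultiPeriod.Past T d t) (MultiPeriod.Path T d))
    [∀ n t, IsMarkovKernel (κn n t)]
    (hκ : ∀ t, 1 ≤ t → t ≤ T → HasCondDistrib (fun ω => (X ω, Y ω))
      (fun ω => MultiPeriod.past t (X ω, Y ω)) (κ t) P)
    (hκn : ∀ n t, 1 ≤ t → t ≤ T → HasCondDistrib (fun ω => (Xn n ω, Yn n ω))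
      (fun ω => MultiPeriod.past t (Xn n ω, Yn n ω)) (κn n t) P)
    -- conditional weak convergence and conditional uniform integrability
    (hcond : ∀ t, 1 ≤ t → t ≤ T →
      ∀ (zn : ℕ → MultiPeriod.Past T d t) (z : MultiPeriod.Past T d t),
        (∀ n, zn n ∈ (P.map (fun ω => MultiPeriod.past t (Xn n ω, Yn n ω))).support) →
        z ∈ (P.map (fun ω => MultiPeriod.past t (X ω, Y ω))).support →
        Tendsto zn atTop (𝓝 z) →
        Tendsto (β := ProbabilityMeasure (MultiPeriod.Path T d))
            (fun n => ⟨κn n t (zn n), inferInstance⟩) atTop (𝓝 ⟨κ t z, inferInstance⟩) ∧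
          MultiPeriod.UnifIntegrableLaws
            (fun n => (κn n t (zn n)).map (fun w => ‖w.1‖ ^ 2)))
    -- the constants of the one-step valuations
    (c : Fin T → ℝ) (hc : ∀ i, 0 ≤ c i) :
    -- `V^n_0(X^n) → V_0(X)`
    (∀ ω, Tendsto (fun n => MultiPeriod.value P c (fun ω' => (Xn n ω', Yn n ω')) 0 ω) atTop
        (𝓝 (MultiPeriod.value P c (fun ω' => (X ω', Y ω')) 0 ω))) ∧
    -- the explicit formula, in terms of standard normal `ε_t` independent of `F_{t-1}`
    (∀ ε : Fin T → Ω → ℝ,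
      (∀ i, Measurable (ε i)) → (∀ i, P.map (ε i) = gaussianReal 0 1) →
      (∀ i : Fin T, Indep (MeasurableSpace.comap (ε i) inferInstance)
        (MultiPeriod.info (fun ω' => (X ω', Y ω')) i) P) →
      ∀ᵐ ω ∂P, MultiPeriod.value P c (fun ω' => (X ω', Y ω')) 0 ω =
        (∫ ω', ∑ i : Fin T, X ω' i ∂P) +
          ∑ i : Fin T, MultiPeriod.oneStep P (MultiPeriod.info (fun ω' => (X ω', Y ω')) i) (c i) (ε i) ω *
            √(MultiPeriod.varDrop P (fun ω' => (X ω', Y ω')) i ω)) ∧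
    -- the coefficients `φ_{t-1}(ε_t)` are the constants `c_{t-1}`
    (∀ (i : Fin T) (ε : Ω → ℝ), Measurable ε → P.map ε = gaussianReal 0 1 →
      Indep (MeasurableSpace.comap ε inferInstance)
        (MultiPeriod.info (fun ω' => (X ω', Y ω')) i) P →
      ∀ᵐ ω ∂P,
        MultiPeriod.oneStep P (MultiPeriod.info (fun ω' => (X ω', Y ω')) i) (c i) ε ω = c i) ∧
    -- the formula with these constants, where all radicands are nonnegative
    (∀ᵐ ω ∂P, (∀ i : Fin T, 0 ≤ MultiPeriod.varDrop P (fun ω' => (X ω', Y ω')) i ω) ∧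
      MultiPeriod.value P c (fun ω' => (X ω', Y ω')) 0 ω =
        (∫ ω', ∑ i : Fin T, X ω' i ∂P) +
          ∑ i : Fin T, c i * √(MultiPeriod.varDrop P (fun ω' => (X ω', Y ω')) i ω)) := by
  have hZ : Measurable fun ω => (X ω, Y ω) := hX.prodMk hY
  have hZn : ∀ n, Measurable fun ω => (Xn n ω, Yn n ω) := fun n => (hXn n).prodMk (hYn n)
  have hUI' : MultiPeriod.UnifIntegrableLaws fun n =>
      (P.map fun ω => (Xn n ω, Yn n ω)).map fun w => ‖w.1‖ ^ 2 := by
    convert hUI using 2 with n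
    rw [Measure.map_map (by fun_prop) (hZn n)]
    rfl
  obtain ⟨δ, hδ0, hδ, hval⟩ := MultiPeriod.exists_value_eq_condExp_add hZ hgauss c
  have hε : ∀ (i : Fin T) (ε : Ω → ℝ), Measurable ε → P.map ε = gaussianReal 0 1 →
      Indep (MeasurableSpace.comap ε inferInstance)
        (MultiPeriod.info (fun ω' => (X ω', Y ω')) i) P →
      ∀ᵐ ω ∂P,
        MultiPeriod.oneStep P (MultiPeriod.info (fun ω' => (X ω', Y ω')) i) (c i) ε ω = c i :=
    fun i ε hm hlaw hind =>
      MultiPeriod.oneStep_standard_normal (MultiPeriod.info_le hZ i) hm hlaw hind (c i)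
  have hformula : ∀ᵐ ω ∂P,
      (∀ i : Fin T, 0 ≤ MultiPeriod.varDrop P (fun ω' => (X ω', Y ω')) i ω) ∧
      MultiPeriod.value P c (fun ω' => (X ω', Y ω')) 0 ω =
        (∫ ω', ∑ i : Fin T, X ω' i ∂P) +
          ∑ i : Fin T, c i * √(MultiPeriod.varDrop P (fun ω' => (X ω', Y ω')) i ω) := by
    filter_upwards [ae_all_iff.2 hδ, hval 0 (Nat.zero_le T)] with ω h1 h2
    refine ⟨fun i => (hδ0 i).trans_eq (h1 i).symm, ?_⟩
    rw [h2, MultiPeriod.info_zero, condExp_bot]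
    simp [h1, MultiPeriod.remaining]
  refine ⟨fun ω => ?_, fun ε hm hlaw hind => ?_, hε, hformula⟩
  · have := Measure.isProbabilityMeasure_map (μ := P) hZ.aemeasurable
    have := fun n => Measure.isProbabilityMeasure_map (μ := P) (hZn n).aemeasurable
    -- The given kernels are conditional laws only for `t ≥ 1`; at `t = 0` they are replaced by the
    -- unconditional law.
    obtain ⟨κ', hκ'M, hκ'0, hκ'⟩ :=
      MultiPeriod.exists_kernel_extend_zero κ (P.map fun ω => (X ω, Y ω))
    choose κn' hκn'M hκn'0 hκn' using fun n =>
      MultiPeriod.exists_kernel_extend_zero (κn n) (P.map fun ω => (Xn n ω, Yn n ω))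
    refine MultiPeriod.tendsto_value_zero (κ := κ') (κn := κn') hZ hZn hlim hgauss
      (MultiPeriod.memLp_fst_of_unifIntegrableLaws hZn hUI') (fun t ht => ?_) (fun n t ht => ?_)
      (fun t ht zn z hzn hz hlimz => ?_) c ω
    · rcases Nat.eq_zero_or_pos t with rfl | h
      · rw [hκ'0]
        exact MultiPeriod.hasCondDistrib_const_of_past_zero hZ
      · rw [hκ' t h]
        exact hκ t h ht
    · rcases Nat.eq_zero_or_pos t with rfl | h
      · rw [hκn'0]
        exact MultiPeriod.hasCondDistrib_const_of_past_zero (hZn n)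
      · rw [hκn' n t h]
        exact hκn n t h ht
    · rcases Nat.eq_zero_or_pos t with rfl | h
      · refine ⟨?_, by simpa only [hκn'0, Kernel.const_apply] using hUI'⟩
        have e : (⟨κ' 0 z, inferInstance⟩ : ProbabilityMeasure (MultiPeriod.Path T d)) =
            ⟨P.map fun ω => (X ω, Y ω), inferInstance⟩ :=
          Subtype.ext (DFunLike.congr_fun hκ'0 z)
        rw [e]
        exact hlim.tendsto.congr fun n =>
          Subtype.ext (DFunLike.congr_fun (hκn'0 n) (zn n)).symm
      · obtain ⟨h1, h2⟩ := hcond t h ht zn z hzn hz hlimz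
        refine ⟨?_, by simpa only [hκn' _ t h] using h2⟩
        have e : (⟨κ' t z, inferInstance⟩ : ProbabilityMeasure (MultiPeriod.Path T d)) =
            ⟨κ t z, inferInstance⟩ := Subtype.ext (DFunLike.congr_fun (hκ' t h) z)
        rw [e]
        exact h1.congr fun n => Subtype.ext (DFunLike.congr_fun (hκn' n t h) (zn n)).symm
  · filter_upwards [hformula, ae_all_iff.2 fun i => hε i (ε i) (hm i) (hlaw i) (hind i)]
      with ω h1 h2
    simp only [h1.2, h2]
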